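/- Let $\mathcal L$ be the class of variable-coefficient Burgers equations $$u_t+C(t,x)\,u\,u_x=A^2(t,x)\,u_{xx}$$ for a real function $u(t,x)$, where $(t,x)$ runs through an open set $D\subset\mathbb R^2$ and $A^2$ and $C$ are smooth functions on $D$ with $A^2C\neq0$ everywhere on $D$ (here $A^2$ is a single symbol with upper index $2$, not a square, while $C^2$ below is the square of $C$). The regular subclass $\mathcal L_1$ of $\mathcal L$ consists of the equations for which the function $$\left(\frac{C_t}{C}-C\left(A^2\,\frac{C_x}{C^2}\right)_{x}\right)_{x}$$ does not vanish identically on $D$. A point transformation $\varphi\colon(t,x,u)\mapsto(\tilde t,\tilde x,\tilde u)$ is a smooth diffeomorphism between open subsets $\Omega$ and $\tilde\Omega$ of $\mathbb R^3$. Assume that $\Omega$ is nonempty and connected, and that its intersections with all planes $t=\mathrm{const}$ and with all lines $(t,x)=\mathrm{const}$ are connected (possibly empty). Denote by $D$ and $\tilde D$ the projections of $\Omega$ and $\tilde\Omega$ to the planes of the independent variables. The transformation $\varphi$ connects an equation over $D$ with an equation over $\tilde D$ if the prolongation of $\varphi$ to second-order jets of functions of the independent variables, wherever it is defined, identifies the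 jets satisfying the first equation with the jets satisfying the second one; that is, whenever $\varphi$ maps the graph of a smooth function $u=f(t,x)$ near a point of this graph into the graph of a smooth function $\tilde u=g(\tilde t,\tilde x)$, the function $f$ satisfies the first equation at that point if and only if $g$ satisfies the second equation at the corresponding point. Let the source equation over $D$, with coefficients $(A^2,C)$, belong to $\mathcal L_1$. Then $\varphi$ connects it with some equation over $\tilde D$ in the class $\mathcal L_1$ if and only if the components of $\varphi$ are, on $\Omega$, of the form $$\tilde t=T(t),\quad \tilde x=X(t,x),\quad \tilde u=U^1u+U^0,$$ where $T$ and $X$ are smooth functions of their arguments and $U^1$ and $U^0$ are constants, with $T_tX_xU^1\neq0$, and $X$ satisfies the Kolmogorov equation $$X_t=A^2X_{xx}+\frac{U^0C}{U^1}X_x .$$ Moreover, an equation over $\tilde D$ with coefficients $(\tilde A^2,\tilde C)$ belongs to $\mathcal L_1$ and is connected by $\varphi$ with the source equation if and only if $\varphi$ is of this form and the coefficients are related by $$\tilde C=\frac{X_x}{T_tU^1}\,C,\qquad \tilde A^2=\frac{X_x^2}{T_t}\,A^2,$$ where the left-hand sides are evaluated at $(\tilde t,\tilde x)=(T(t),X(t,x))$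 and the right-hand sides at $(t,x)$, for all $(t,x)\in D$. -/

import Mathlib

open Set Filter
open scoped Topology ContDiff

noncomputable section

namespace VarBurgers

/-- The partial derivative `∂f/∂t` of a function of `(t, x)`. -/
def dt (f : ℝ × ℝ → ℝ) (p : ℝ × ℝ) : ℝ := fderiv ℝ f p (1, 0)

/-- The partial derivative `∂f/∂x` of a function of `(t, x)`. -/
def dx (f : ℝ × ℝ → ℝ) (p : ℝ × ℝ) : ℝ := fderiv ℝ f p (0, 1)

/-- The projection `(t, x, u) ↦ (t, x)` onto the independent variables. -/
def base (q : ℝ × ℝ × ℝ) : ℝ × ℝ := (q.1, q.2.1)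

/-- The tuple of arbitrary elements `(A², C)` of the equation `u_t + C u u_x = A² u_xx`. The values
outside the domain of `(t, x)` under consideration are irrelevant. -/
structure Coeffs where
  A2 : ℝ × ℝ → ℝ
  C : ℝ × ℝ → ℝ

/-- The equation with coefficients `θ` belongs to the class `L` over the domain `D`:
`A²` and `C` are smooth on `D` and `A² C ≠ 0`. -/
structure InL (D : Set (ℝ × ℝ)) (θ : Coeffs) : Prop where
  smooth_A2 : ContDiffOn ℝ ∞ θ.A2 D
  smooth_C : ContDiffOn ℝ ∞ θ.C D
  ne_zero : ∀ p ∈ D, θ.A2 p * θ.C p ≠ 0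

/-- The function `C_t / C - C (A² C_x / C²)_x`. -/
def splitting (θ : Coeffs) (p : ℝ × ℝ) : ℝ :=
  dt θ.C p / θ.C p - θ.C p * dx (fun q => θ.A2 q * (dx θ.C q / θ.C q ^ 2)) p

/-- The regular subclass `L₁`, the complement in `L` of the subclass of singular equations, for which
`(C_t / C - C (A² C_x / C²)_x)_x` vanishes identically on `D`:
`(C_t / C - C (A² C_x / C²)_x)_x ≠ 0` as a function on `D`. -/
def InL1 (D : Set (ℝ × ℝ)) (θ : Coeffs) : Prop :=
  InL D θ ∧ ∃ p ∈ D, dx (splitting θ) p ≠ 0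

/-- `u_t + C u u_x - A² u_xx` at the point `p`, for the function `f` in the role of `u`. -/
def burgersResidual (θ : Coeffs) (f : ℝ × ℝ → ℝ) (p : ℝ × ℝ) : ℝ :=
  dt f p + θ.C p * f p * dx f p - θ.A2 p * dx (dx f) p

/-- The point of the graph `u = f(t, x)` over `p`. -/
def lift (f : ℝ × ℝ → ℝ) (p : ℝ × ℝ) : ℝ × ℝ × ℝ := (p.1, p.2, f p)

/-- A point transformation of the space with coordinates `(t, x, u)`: a diffeomorphism between
open subsets `φ.source` and `φ.target`. -/
structure IsPointTransformation
    (φ : OpenPartialHomeomorph (ℝ × ℝ × ℝ) (ℝ × ℝ × ℝ)) : Prop where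
  smooth : ContDiffOn ℝ ∞ φ φ.source
  smooth_symm : ContDiffOn ℝ ∞ φ.symm φ.target

/-- The source of `φ` is a (nonempty) domain on which a function with vanishing `x`- and
`u`-derivatives is a function of `t`, and one with vanishing `u`-derivative is a function of
`(t, x)`: it is connected, and so are its intersections with the planes `t = const` and with the
lines `(t, x) = const`. -/
structure HasConnectedSlices (Ω : Set (ℝ × ℝ × ℝ)) : Prop where
  connected : IsConnected Ω
  slice_t : ∀ t : ℝ, IsPreconnected {z : ℝ × ℝ | (t, z.1, z.2) ∈ Ω}
  slice_tx : ∀ t x : ℝ, IsPreconnected {u : ℝ | (t, x, u) ∈ Ω}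

/-- Near the point of its graph over `p`, the function `f` (smooth at `p`) is mapped by `φ` to the
function `g` (smooth at the corresponding point): `φ` maps the graph of `f` into that of `g`. -/
structure MapsFunctionAt (φ : OpenPartialHomeomorph (ℝ × ℝ × ℝ) (ℝ × ℝ × ℝ))
    (f g : ℝ × ℝ → ℝ) (p : ℝ × ℝ) : Prop where
  mem_source : lift f p ∈ φ.source
  smooth_f : ContDiffAt ℝ ∞ f p
  smooth_g : ContDiffAt ℝ ∞ g (base (φ (lift f p)))
  graph : ∀ᶠ q in 𝓝 p, (φ (lift f q)).2.2 = g (base (φ (lift f q)))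

/-- `φ` connects the equations with coefficients `θ` and `θ'`: the prolongation of `φ` to the
second-order jets of functions `u(t, x)`, given by its action on the functions representing the
jets, identifies the jets that satisfy the source equation with those that satisfy the target
equation. -/
def Connects (φ : OpenPartialHomeomorph (ℝ × ℝ × ℝ) (ℝ × ℝ × ℝ)) (θ θ' : Coeffs) : Prop :=
  ∀ (f g : ℝ × ℝ → ℝ) (p : ℝ × ℝ), MapsFunctionAt φ f g p →
    (burgersResidual θ f p = 0 ↔ burgersResidual θ' g (base (φ (lift f p))) = 0)

/-- `φ` has the form `t̃ = T(t)`, `x̃ = X(t, x)`, `ũ = U¹ u + U⁰`, with smooth `T`, `X` and constants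
`U¹`, `U⁰` such that `T_t X_x U¹ ≠ 0` and `X_t = A² X_xx + (U⁰ C / U¹) X_x`. -/
structure HasForm (φ : OpenPartialHomeomorph (ℝ × ℝ × ℝ) (ℝ × ℝ × ℝ)) (θ : Coeffs)
    (T : ℝ → ℝ) (X : ℝ × ℝ → ℝ) (U1 U0 : ℝ) : Prop where
  smooth_T : ContDiffOn ℝ ∞ T (Prod.fst '' φ.source)
  smooth_X : ContDiffOn ℝ ∞ X (base '' φ.source)
  components : ∀ t x u : ℝ, (t, x, u) ∈ φ.source → φ (t, x, u) = (T t, X (t, x), U1 * u + U0)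
  nondegenerate : ∀ p ∈ base '' φ.source, deriv T p.1 * dx X p * U1 ≠ 0
  kolmogorov : ∀ p ∈ base '' φ.source,
    dt X p = θ.A2 p * dx (dx X) p + U0 * θ.C p / U1 * dx X p

end VarBurgers

end

/-! Necessity rests on the freedom of the jets satisfying the source equation. Quadratic functions
realize every value, slope and diagonal Hessian at a point. Whenever the image graph is transversal
to the fibres, such a function is mapped to a function `g` (`exists_mapsFunctionAt`), and
`Connects.jet_criterion` turns the target equation into an explicit condition on the source jet. The
form of `φ` follows by varying one jet coordinate at a time: `u_tt` gives `T_x = T_u = 0`; `u_xx`,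
compensated by `u_t`, gives `X_u = 0` and the rule for `A²`; the slope `u_x` gives `U_uu = 0`.
Connected slices then make `T`, `X`, `U¹`, `U⁰` functions of `t` or of `(t, x)`
(`Connects.isFiberAffine`).

The remaining condition is polynomial in `u` and `u_x`. Splitting it
(`IsFiberAffine.determining_equations`) yields the rule for `C`, the Kolmogorov equation, and the
system `U¹_x = 0`, `U¹_t + C U⁰_x = 0`, `U⁰_t = A² U⁰_xx`. With `W = U¹_t` and `S` the function
`splitting`, equality of the mixed derivatives of `U⁰` gives `W_t = S W`, while `W_x = 0`. Hence
`S_x W = 0`, so `W` vanishes where `S_x ≠ 0`; regularity supplies one such point, and uniqueness for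
the linear equation together with connectedness spreads the zero over `D` (`InL1.dt_eq_zero`). So
`U¹`, and then `U⁰`, is constant.

Conversely, for a transformation of the stated form with the stated coefficients, the chain rule
shows that `T_t` times the target residual equals `U¹` times the source residual
(`HasForm.connects`). Regularity is inherited because `S̃ = (S - T_tt / T_t) / T_t`
(`HasForm.splitting_eq`), so `S_x` is only multiplied by nonzero factors. The target coefficients
are well defined as functions on `D̃` because `(t, x) ↦ (T, X)` is injective (`HasForm.injOn`). -/

namespace VarBurgers

/-! ### Calculus of `dt`, `dx` and second derivatives along curves. -/

section Calculus

variable {f g : ℝ × ℝ → ℝ} {p : ℝ × ℝ} {D : Set (ℝ × ℝ)}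

theorem dt_add (hf : DifferentiableAt ℝ f p) (hg : DifferentiableAt ℝ g p) :
    dt (fun q => f q + g q) p = dt f p + dt g p := by
  simp [dt, fderiv_fun_add hf hg]

theorem dx_add (hf : DifferentiableAt ℝ f p) (hg : DifferentiableAt ℝ g p) :
    dx (fun q => f q + g q) p = dx f p + dx g p := by
  simp [dx, fderiv_fun_add hf hg]

theorem dx_sub (hf : DifferentiableAt ℝ f p) (hg : DifferentiableAt ℝ g p) :
    dx (fun q => f q - g q) p = dx f p - dx g p := by
  simp [dx, fderiv_fun_sub hf hg]

theorem dt_mul (hf : DifferentiableAt ℝ f p) (hg : DifferentiableAt ℝ g p) :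
    dt (fun q => f q * g q) p = dt f p * g p + f p * dt g p := by
  simp [dt, fderiv_fun_mul hf hg]; ring

theorem dx_mul (hf : DifferentiableAt ℝ f p) (hg : DifferentiableAt ℝ g p) :
    dx (fun q => f q * g q) p = dx f p * g p + f p * dx g p := by
  simp [dx, fderiv_fun_mul hf hg]; ring

theorem dt_const (a : ℝ) : dt (fun _ => a) p = 0 := by simp [dt]

theorem dx_const (a : ℝ) : dx (fun _ => a) p = 0 := by simp [dx]

theorem dt_congr (h : f =ᶠ[𝓝 p] g) : dt f p = dt g p := by rw [dt, h.fderiv_eq, dt]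

theorem dx_congr (h : f =ᶠ[𝓝 p] g) : dx f p = dx g p := by rw [dx, h.fderiv_eq, dx]

theorem differentiableAt_div (hf : DifferentiableAt ℝ f p) (hg : DifferentiableAt ℝ g p)
    (h0 : g p ≠ 0) : DifferentiableAt ℝ (fun q => f q / g q) p := by
  simpa only [div_eq_mul_inv] using hf.fun_mul (hg.fun_inv h0)

theorem dt_div (hf : DifferentiableAt ℝ f p) (hg : DifferentiableAt ℝ g p) (h0 : g p ≠ 0) :
    dt (fun q => f q / g q) p = (dt f p * g p - f p * dt g p) / g p ^ 2 := by
  have hr : DifferentiableAt ℝ (fun q => f q / g q) p := differentiableAt_div hf hg h0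
  -- The quotient rule is the product rule for `f = (f / g) * g`, solved for the derivative of `f /
  -- g`.
  have h : dt f p = dt (fun q => f q / g q * g q) p :=
    dt_congr ((hg.continuousAt.eventually_ne h0).mono fun q hq => (div_mul_cancel₀ _ hq).symm)
  rw [dt_mul hr hg] at h
  rw [h]
  field_simp
  ring

theorem dx_div (hf : DifferentiableAt ℝ f p) (hg : DifferentiableAt ℝ g p) (h0 : g p ≠ 0) :
    dx (fun q => f q / g q) p = (dx f p * g p - f p * dx g p) / g p ^ 2 := by
  have hr : DifferentiableAt ℝ (fun q => f q / g q) p := differentiableAt_div hf hg h0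
  have h : dx f p = dx (fun q => f q / g q * g q) p :=
    dx_congr ((hg.continuousAt.eventually_ne h0).mono fun q hq => (div_mul_cancel₀ _ hq).symm)
  rw [dx_mul hr hg] at h
  rw [h]
  field_simp
  ring

theorem dt_congr_of_eqOn (hD : IsOpen D) (h : EqOn f g D) (hp : p ∈ D) : dt f p = dt g p :=
  dt_congr (h.eventuallyEq_of_mem (hD.mem_nhds hp))

theorem dx_congr_of_eqOn (hD : IsOpen D) (h : EqOn f g D) (hp : p ∈ D) : dx f p = dx g p :=
  dx_congr (h.eventuallyEq_of_mem (hD.mem_nhds hp))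

theorem fderiv_pair (f : ℝ × ℝ → ℝ) (p : ℝ × ℝ) (a b : ℝ) :
    fderiv ℝ f p (a, b) = a * dt f p + b * dx f p := by
  have : ((a, b) : ℝ × ℝ) = a • (1, 0) + b • (0, 1) := by simp
  rw [this, map_add, map_smul, map_smul]; simp [dt, dx]

theorem contDiffOn_dt (hD : IsOpen D) (hf : ContDiffOn ℝ ∞ f D) : ContDiffOn ℝ ∞ (dt f) D :=
  (hf.fderiv_of_isOpen hD (m := ∞) (by simp)).clm_apply contDiffOn_const

theorem contDiffOn_dx (hD : IsOpen D) (hf : ContDiffOn ℝ ∞ f D) : ContDiffOn ℝ ∞ (dx f) D :=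
  (hf.fderiv_of_isOpen hD (m := ∞) (by simp)).clm_apply contDiffOn_const

theorem contDiffAt_dx (hf : ContDiffAt ℝ ∞ f p) : ContDiffAt ℝ ∞ (dx f) p :=
  (hf.fderiv_right (m := ∞) (by simp)).clm_apply contDiffAt_const

theorem differentiableAt_of_contDiffOn {E : Type*} [NormedAddCommGroup E] [NormedSpace ℝ E]
    {F : E → ℝ} {s : Set E} {q : E}
    (hs : IsOpen s) (hF : ContDiffOn ℝ ∞ F s) (hq : q ∈ s) : DifferentiableAt ℝ F q :=
  (hF.contDiffAt (hs.mem_nhds hq)).differentiableAt (by simp)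

theorem dir_dir {E : Type*} [NormedAddCommGroup E] [NormedSpace ℝ E] {F : E → ℝ} {q : E}
    (hF : ContDiffAt ℝ 2 F q) (v w : E) :
    fderiv ℝ (fun q' => fderiv ℝ F q' v) q w = fderiv ℝ (fderiv ℝ F) q w v := by
  have h : DifferentiableAt ℝ (fderiv ℝ F) q :=
    (hF.fderiv_right (m := 1) (by norm_num)).differentiableAt (by simp)
  rw [fderiv_clm_apply h (differentiableAt_const v)]
  simp

theorem dx_dx (hf : ContDiffAt ℝ 2 f p) :
    dx (dx f) p = fderiv ℝ (fderiv ℝ f) p (0, 1) (0, 1) := dir_dir hf _ _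

theorem fderiv_fderiv_symm {E : Type*} [NormedAddCommGroup E] [NormedSpace ℝ E] {F : E → ℝ} {q : E}
    (hF : ContDiffAt ℝ 2 F q) (v w : E) :
    fderiv ℝ (fderiv ℝ F) q v w = fderiv ℝ (fderiv ℝ F) q w v :=
  (hF.isSymmSndFDerivAt (by simp)) v w

theorem dt_dx_comm (hf : ContDiffAt ℝ 2 f p) : dt (dx f) p = dx (dt f) p := by
  have h1 : dt (dx f) p = _ := dir_dir hf (0, 1) (1, 0)
  have h2 : dx (dt f) p = _ := dir_dir hf (1, 0) (0, 1)
  rw [h1, h2, fderiv_fderiv_symm hf]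

theorem hasDerivAt_fderiv_apply {E F : Type*} [NormedAddCommGroup E] [NormedSpace ℝ E]
    [NormedAddCommGroup F] [NormedSpace ℝ F] {G : E → F} {c c' : ℝ → E} {c'' : E} {s : ℝ}
    (hG : ContDiffAt ℝ 2 G (c s)) (hc : HasDerivAt c (c' s) s) (hc' : HasDerivAt c' c'' s) :
    HasDerivAt (fun r => fderiv ℝ G (c r) (c' r))
      (fderiv ℝ (fderiv ℝ G) (c s) (c' s) (c' s) + fderiv ℝ G (c s) c'') s := by
  have h : HasFDerivAt (fderiv ℝ G) (fderiv ℝ (fderiv ℝ G) (c s)) (c s) :=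
    ((hG.fderiv_right (m := 1) (by norm_num)).differentiableAt (by simp)).hasFDerivAt
  exact (h.comp_hasDerivAt s hc).clm_apply hc'

/-- The first and second derivatives of the relation `υ = g(τ, ξ)` along a curve. -/
theorem graph_relation {E : Type*} [NormedAddCommGroup E] [NormedSpace ℝ E] {τ ξ υ : E → ℝ}
    {g : ℝ × ℝ → ℝ} {c c' : ℝ → E} {c'' : E}
    (hτ : ContDiffAt ℝ 2 τ (c 0)) (hξ : ContDiffAt ℝ 2 ξ (c 0)) (hυ : ContDiffAt ℝ 2 υ (c 0))
    (hg : ContDiffAt ℝ 2 g (τ (c 0), ξ (c 0)))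
    (hc : ∀ᶠ s in 𝓝 0, HasDerivAt c (c' s) s) (hc' : HasDerivAt c' c'' 0)
    (h : ∀ᶠ s in 𝓝 0, υ (c s) = g (τ (c s), ξ (c s))) :
    fderiv ℝ τ (c 0) (c' 0) * dt g (τ (c 0), ξ (c 0)) +
        fderiv ℝ ξ (c 0) (c' 0) * dx g (τ (c 0), ξ (c 0)) = fderiv ℝ υ (c 0) (c' 0) ∧
      fderiv ℝ (fderiv ℝ g) (τ (c 0), ξ (c 0))
          (fderiv ℝ τ (c 0) (c' 0), fderiv ℝ ξ (c 0) (c' 0))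
          (fderiv ℝ τ (c 0) (c' 0), fderiv ℝ ξ (c 0) (c' 0)) +
        ((fderiv ℝ (fderiv ℝ τ) (c 0) (c' 0) (c' 0) + fderiv ℝ τ (c 0) c'') *
            dt g (τ (c 0), ξ (c 0)) +
          (fderiv ℝ (fderiv ℝ ξ) (c 0) (c' 0) (c' 0) + fderiv ℝ ξ (c 0) c'') *
            dx g (τ (c 0), ξ (c 0))) =
        fderiv ℝ (fderiv ℝ υ) (c 0) (c' 0) (c' 0) + fderiv ℝ υ (c 0) c'' := by
  have hc0 := hc.self_of_nhds
  have hcc : Tendsto c (𝓝 0) (𝓝 (c 0)) := hc0.continuousAt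
  have hκ : Tendsto (fun s => (τ (c s), ξ (c s))) (𝓝 0) (𝓝 (τ (c 0), ξ (c 0))) :=
    (hτ.continuousAt.tendsto.comp hcc).prodMk_nhds (hξ.continuousAt.tendsto.comp hcc)
  have ev : ∀ᶠ s in 𝓝 0, HasDerivAt (fun r => (τ (c r), ξ (c r)))
      (fderiv ℝ τ (c s) (c' s), fderiv ℝ ξ (c s) (c' s)) s := by
    filter_upwards [hc, hcc.eventually (hτ.eventually (by simp)),
      hcc.eventually (hξ.eventually (by simp))] with s h1 h2 h3
    exact ((h2.differentiableAt (by simp)).hasFDerivAt.comp_hasDerivAt s h1).prodMk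
      ((h3.differentiableAt (by simp)).hasFDerivAt.comp_hasDerivAt s h1)
  -- The first-order relation is established for all `s` near `0`, since it is differentiated once
  -- more at `0`.
  have key : ∀ᶠ s in 𝓝 0, fderiv ℝ g (τ (c s), ξ (c s))
      (fderiv ℝ τ (c s) (c' s), fderiv ℝ ξ (c s) (c' s)) = fderiv ℝ υ (c s) (c' s) := by
    filter_upwards [hc, ev, hcc.eventually (hυ.eventually (by simp)),
      hκ.eventually (hg.eventually (by simp)), h.eventually_nhds] with s h1 h2 h3 h4 h5
    have e1 := (h3.differentiableAt (by simp)).hasFDerivAt.comp_hasDerivAt s h1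
    have e2 := (h4.differentiableAt (by simp)).hasFDerivAt.comp_hasDerivAt_of_eq s h2 rfl
    exact e2.unique (e1.congr_of_eventuallyEq (h5.mono fun _ hr => hr.symm))
  refine ⟨by rw [← fderiv_pair]; exact key.self_of_nhds, ?_⟩
  have hκ' := (hasDerivAt_fderiv_apply hτ hc0 hc').prodMk (hasDerivAt_fderiv_apply hξ hc0 hc')
  have e1 := hasDerivAt_fderiv_apply (c := fun r => (τ (c r), ξ (c r))) hg ev.self_of_nhds hκ'
  have e2 := hasDerivAt_fderiv_apply hυ hc0 hc'
  rw [← fderiv_pair]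
  exact e1.unique (e2.congr_of_eventuallyEq key)

end Calculus

/-! ### Second prolongation of a point transformation, tested on quadratic functions. -/

section Prolongation

variable {φ : OpenPartialHomeomorph (ℝ × ℝ × ℝ) (ℝ × ℝ × ℝ)} {q : ℝ × ℝ × ℝ}

/-- The `t`-component of a point transformation. -/
def compT (φ : OpenPartialHomeomorph (ℝ × ℝ × ℝ) (ℝ × ℝ × ℝ)) (q : ℝ × ℝ × ℝ) : ℝ := (φ q).1

/-- The `x`-component of a point transformation. -/
def compX (φ : OpenPartialHomeomorph (ℝ × ℝ × ℝ) (ℝ × ℝ × ℝ)) (q : ℝ × ℝ × ℝ) : ℝ := (φ q).2.1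

/-- The `u`-component of a point transformation. -/
def compU (φ : OpenPartialHomeomorph (ℝ × ℝ × ℝ) (ℝ × ℝ × ℝ)) (q : ℝ × ℝ × ℝ) : ℝ := (φ q).2.2

theorem IsPointTransformation.contDiffOn_compT (hφ : IsPointTransformation φ) :
    ContDiffOn ℝ ∞ (compT φ) φ.source := contDiff_fst.comp_contDiffOn hφ.smooth

theorem IsPointTransformation.contDiffOn_compX (hφ : IsPointTransformation φ) :
    ContDiffOn ℝ ∞ (compX φ) φ.source :=
  (contDiff_fst.comp contDiff_snd).comp_contDiffOn hφ.smooth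

theorem IsPointTransformation.contDiffOn_compU (hφ : IsPointTransformation φ) :
    ContDiffOn ℝ ∞ (compU φ) φ.source :=
  (contDiff_snd.comp contDiff_snd).comp_contDiffOn hφ.smooth

theorem contDiffAt_two_of_contDiffOn {E : Type*} [NormedAddCommGroup E] [NormedSpace ℝ E]
    {F : E → ℝ} {s : Set E} {q : E}
    (hs : IsOpen s) (hF : ContDiffOn ℝ ∞ F s) (hq : q ∈ s) : ContDiffAt ℝ 2 F q :=
  by exact_mod_cast contDiffAt_infty.1 (hF.contDiffAt (hs.mem_nhds hq)) 2

/-- The differential of a point transformation is surjective. -/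
theorem IsPointTransformation.exists_fderiv_eq (hφ : IsPointTransformation φ) (hq : q ∈ φ.source)
    (α β γ : ℝ) : ∃ w, fderiv ℝ (compT φ) q w = α ∧ fderiv ℝ (compX φ) q w = β ∧
      fderiv ℝ (compU φ) q w = γ := by
  have h1 : HasFDerivAt φ (fderiv ℝ φ q) q :=
    ((hφ.smooth.contDiffAt (φ.open_source.mem_nhds hq)).differentiableAt (by simp)).hasFDerivAt
  have h2 : HasFDerivAt φ.symm (fderiv ℝ φ.symm (φ q)) (φ q) :=
    ((hφ.smooth_symm.contDiffAt (φ.open_target.mem_nhds (φ.map_source hq))).differentiableAt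
      (by simp)).hasFDerivAt
  have h1' : HasFDerivAt φ (fderiv ℝ φ q) (φ.symm (φ q)) := by rwa [φ.left_inv hq]
  have h3 := h1'.comp (φ q) h2
  have h4 : HasFDerivAt (φ ∘ φ.symm) (ContinuousLinearMap.id ℝ (ℝ × ℝ × ℝ)) (φ q) :=
    (hasFDerivAt_id _).congr_of_eventuallyEq
      (φ.eventually_right_inverse (φ.map_source hq))
  have h5 := h3.unique h4
  refine ⟨fderiv ℝ φ.symm (φ q) (α, β, γ), ?_⟩
  have h6 : fderiv ℝ φ q (fderiv ℝ φ.symm (φ q) (α, β, γ)) = (α, β, γ) := by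
    have := congrArg (fun l => l (α, β, γ)) h5
    simpa using this
  have eT : HasFDerivAt (compT φ) _ q := h1.fst
  have eX : HasFDerivAt (compX φ) _ q := h1.snd.fst
  have eU : HasFDerivAt (compU φ) _ q := h1.snd.snd
  rw [eT.fderiv, eX.fderiv, eU.fderiv]
  simp [h6]

theorem fderiv_triple (F : ℝ × ℝ × ℝ → ℝ) (q : ℝ × ℝ × ℝ) (a b c : ℝ) :
    fderiv ℝ F q (a, b, c) =
      a * fderiv ℝ F q (1, 0, 0) + b * fderiv ℝ F q (0, 1, 0) + c * fderiv ℝ F q (0, 0, 1) := by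
  have : ((a, b, c) : ℝ × ℝ × ℝ) = a • (1, 0, 0) + b • (0, 1, 0) + c • (0, 0, 1) := by simp
  rw [this]; simp only [map_add, map_smul, smul_eq_mul]

/-- The quadratic function with value `u`, gradient `(b, a)` and diagonal Hessian `(r, c)` at `p`. -/
noncomputable def quadratic (p : ℝ × ℝ) (u b a r c : ℝ) (q : ℝ × ℝ) : ℝ :=
  u + b * (q.1 - p.1) + a * (q.2 - p.2) + r / 2 * (q.1 - p.1) ^ 2 + c / 2 * (q.2 - p.2) ^ 2

theorem contDiff_quadratic {p : ℝ × ℝ} {u b a r c : ℝ} :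
    ContDiff ℝ ∞ (quadratic p u b a r c) := by
  unfold quadratic; fun_prop

theorem hasFDerivAt_quadratic {p : ℝ × ℝ} {u b a r c : ℝ} (q : ℝ × ℝ) :
    HasFDerivAt (quadratic p u b a r c)
      ((b + r * (q.1 - p.1)) • ContinuousLinearMap.fst ℝ ℝ ℝ +
        (a + c * (q.2 - p.2)) • ContinuousLinearMap.snd ℝ ℝ ℝ) q := by
  have h1 : HasFDerivAt (fun q : ℝ × ℝ => q.1 - p.1) (ContinuousLinearMap.fst ℝ ℝ ℝ) q :=
    hasFDerivAt_fst.sub_const _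
  have h2 : HasFDerivAt (fun q : ℝ × ℝ => q.2 - p.2) (ContinuousLinearMap.snd ℝ ℝ ℝ) q :=
    hasFDerivAt_snd.sub_const _
  have h := ((((h1.const_mul b).const_add u).add (h2.const_mul a)).add
    ((h1.pow 2).const_mul (r / 2))).add ((h2.pow 2).const_mul (c / 2))
  refine (h.congr_fderiv ?_)
  ext <;> simp <;> ring

variable {p : ℝ × ℝ} {u b a r c : ℝ}

theorem quadratic_self : quadratic p u b a r c p = u := by simp [quadratic]

theorem lift_quadratic : lift (quadratic p u b a r c) p = (p.1, p.2, u) := by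
  simp [lift, quadratic_self]

theorem dt_quadratic : dt (quadratic p u b a r c) p = b := by
  simp [dt, (hasFDerivAt_quadratic p).fderiv]

theorem dx_quadratic : dx (quadratic p u b a r c) p = a := by
  simp [dx, (hasFDerivAt_quadratic p).fderiv]

theorem dx_dx_quadratic : dx (dx (quadratic p u b a r c)) p = c := by
  have : dx (quadratic p u b a r c) = fun q => a + c * (q.2 - p.2) := by
    funext q; simp [dx, (hasFDerivAt_quadratic q).fderiv]
  rw [this, dx]
  have h2 : HasFDerivAt (fun q : ℝ × ℝ => q.2 - p.2) (ContinuousLinearMap.snd ℝ ℝ ℝ) p :=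
    hasFDerivAt_snd.sub_const _
  rw [((h2.const_mul c).const_add a).fderiv]
  simp

theorem burgersResidual_quadratic (θ : Coeffs) :
    burgersResidual θ (quadratic p u b a r c) p = b + θ.C p * u * a - θ.A2 p * c := by
  simp [burgersResidual, dt_quadratic, dx_quadratic, dx_dx_quadratic, quadratic_self]

/-- A function whose graph stays transversal to the fibres after the transformation is mapped to
some function. -/
theorem exists_mapsFunctionAt (hφ : IsPointTransformation φ) (hq : (p.1, p.2, u) ∈ φ.source)
    (hΔ : fderiv ℝ (compT φ) (p.1, p.2, u) (1, 0, b) * fderiv ℝ (compX φ) (p.1, p.2, u) (0, 1, a) -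
      fderiv ℝ (compT φ) (p.1, p.2, u) (0, 1, a) * fderiv ℝ (compX φ) (p.1, p.2, u) (1, 0, b) ≠ 0) :
    ∃ g, MapsFunctionAt φ (quadratic p u b a r c) g p := by
  set f := quadratic p u b a r c with hf
  have hlp : lift f p = (p.1, p.2, u) := lift_quadratic
  have hl : ContDiff ℝ ∞ (lift f) :=
    contDiff_fst.prodMk (contDiff_snd.prodMk contDiff_quadratic)
  have hl' : HasFDerivAt (lift f) ((ContinuousLinearMap.fst ℝ ℝ ℝ).prod
      ((ContinuousLinearMap.snd ℝ ℝ ℝ).prod (b • ContinuousLinearMap.fst ℝ ℝ ℝ +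
        a • ContinuousLinearMap.snd ℝ ℝ ℝ))) p := by
    have := hasFDerivAt_quadratic (p := p) (u := u) (b := b) (a := a) (r := r) (c := c) p
    simp only [sub_self, mul_zero, add_zero] at this
    exact hasFDerivAt_fst.prodMk (hasFDerivAt_snd.prodMk this)
  have hs : φ.source ∈ 𝓝 (lift f p) := φ.open_source.mem_nhds (hlp ▸ hq)
  have hB : ContDiffAt ℝ ∞ (fun q => (compT φ q, compX φ q)) (lift f p) :=
    (hφ.contDiffOn_compT.contDiffAt hs).prodMk (hφ.contDiffOn_compX.contDiffAt hs)
  have hΦ : ContDiffAt ℝ ∞ (fun q => base (φ (lift f q))) p :=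
    ContDiffAt.comp p hB hl.contDiffAt
  have hB' : HasFDerivAt (fun q => (compT φ q, compX φ q))
      ((fderiv ℝ (compT φ) (lift f p)).prod (fderiv ℝ (compX φ) (lift f p))) (lift f p) :=
    ((hφ.contDiffOn_compT.contDiffAt hs).differentiableAt (by simp)).hasFDerivAt.prodMk
      ((hφ.contDiffOn_compX.contDiffAt hs).differentiableAt (by simp)).hasFDerivAt
  have hΦ' := hB'.comp p hl'
  set M := ((fderiv ℝ (compT φ) (lift f p)).prod (fderiv ℝ (compX φ) (lift f p))).comp
    ((ContinuousLinearMap.fst ℝ ℝ ℝ).prod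
      ((ContinuousLinearMap.snd ℝ ℝ ℝ).prod (b • ContinuousLinearMap.fst ℝ ℝ ℝ +
        a • ContinuousLinearMap.snd ℝ ℝ ℝ))) with hM
  -- `hΔ` says that the Jacobian determinant of `q ↦ base (φ (lift f q))` at `p` is nonzero;
  -- Cramer's rule gives injectivity, and the inverse function theorem then inverts this map near
  -- `p`.
  have hker : ∀ v, M v = 0 → v = 0 := by
    rintro ⟨v1, v2⟩ hv
    simp only [hM, ContinuousLinearMap.comp_apply, ContinuousLinearMap.prod_apply,
      ContinuousLinearMap.coe_fst', ContinuousLinearMap.coe_snd', add_apply,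
      smul_apply, smul_eq_mul, Prod.mk_eq_zero, hlp] at hv
    obtain ⟨hv1, hv2⟩ := hv
    rw [fderiv_triple] at hv1 hv2
    simp only [fderiv_triple _ _ 1 0 b, fderiv_triple _ _ 0 1 a] at hΔ
    have e1 : v1 = 0 := by
      refine (mul_eq_zero.mp ?_).resolve_right hΔ
      linear_combination (fderiv ℝ (compX φ) (p.1, p.2, u) (0, 1, 0) +
        a * fderiv ℝ (compX φ) (p.1, p.2, u) (0, 0, 1)) * hv1 -
        (fderiv ℝ (compT φ) (p.1, p.2, u) (0, 1, 0) +
        a * fderiv ℝ (compT φ) (p.1, p.2, u) (0, 0, 1)) * hv2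
    have e2 : v2 = 0 := by
      refine (mul_eq_zero.mp ?_).resolve_right hΔ
      linear_combination -(fderiv ℝ (compX φ) (p.1, p.2, u) (1, 0, 0) +
        b * fderiv ℝ (compX φ) (p.1, p.2, u) (0, 0, 1)) * hv1 +
        (fderiv ℝ (compT φ) (p.1, p.2, u) (1, 0, 0) +
        b * fderiv ℝ (compT φ) (p.1, p.2, u) (0, 0, 1)) * hv2
    simp [e1, e2]
  let e : (ℝ × ℝ) ≃L[ℝ] (ℝ × ℝ) := (LinearEquiv.ofInjectiveEndo (M : (ℝ × ℝ) →ₗ[ℝ] (ℝ × ℝ))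
    ((injective_iff_map_eq_zero _).mpr hker)).toContinuousLinearEquiv
  have he : HasFDerivAt (fun q => base (φ (lift f q))) (e : (ℝ × ℝ) →L[ℝ] (ℝ × ℝ)) p := hΦ'
  let ψ := hΦ.localInverse he (by simp)
  have hψ : ContDiffAt ℝ ∞ ψ (base (φ (lift f p))) := hΦ.to_localInverse he (by simp)
  have hψp : ψ (base (φ (lift f p))) = p := hΦ.localInverse_apply_image he (by simp)
  refine ⟨fun y => compU φ (lift f (ψ y)), ⟨hlp ▸ hq, contDiff_quadratic.contDiffAt, ?_, ?_⟩⟩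
  · have h1 : ContDiffAt ℝ ∞ (fun q => compU φ (lift f q)) p :=
      ContDiffAt.comp (g := compU φ) p (hφ.contDiffOn_compU.contDiffAt hs) hl.contDiffAt
    exact ContDiffAt.comp (g := fun q => compU φ (lift f q)) _ (by rwa [hψp]) hψ
  · have := (hΦ.hasStrictFDerivAt' he (by simp)).eventually_left_inverse
    filter_upwards [this] with y hy
    rw [show ψ (base (φ (lift f y))) = y from hy]; rfl

/-- The action of the second prolongation of a point transformation, in the form needed here. -/
theorem MapsFunctionAt.prolongation {g : ℝ × ℝ → ℝ} (hφ : IsPointTransformation φ)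
    (h : MapsFunctionAt φ (quadratic p u b a r c) g p) (v₁ v₂ : ℝ) :
    let q : ℝ × ℝ × ℝ := (p.1, p.2, u)
    let y := base (φ q)
    let e : ℝ × ℝ × ℝ := (v₁, v₂, b * v₁ + a * v₂)
    let e' : ℝ × ℝ × ℝ := (0, 0, r * v₁ ^ 2 + c * v₂ ^ 2)
    fderiv ℝ (compT φ) q e * dt g y + fderiv ℝ (compX φ) q e * dx g y =
        fderiv ℝ (compU φ) q e ∧
      fderiv ℝ (fderiv ℝ g) y (fderiv ℝ (compT φ) q e, fderiv ℝ (compX φ) q e)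
          (fderiv ℝ (compT φ) q e, fderiv ℝ (compX φ) q e) +
        ((fderiv ℝ (fderiv ℝ (compT φ)) q e e + fderiv ℝ (compT φ) q e') * dt g y +
          (fderiv ℝ (fderiv ℝ (compX φ)) q e e + fderiv ℝ (compX φ) q e') * dx g y) =
        fderiv ℝ (fderiv ℝ (compU φ)) q e e + fderiv ℝ (compU φ) q e' := by
  intro q y e e'
  have hlp : lift (quadratic p u b a r c) p = q := lift_quadratic
  have hq : q ∈ φ.source := hlp ▸ h.mem_source
  -- The curve on the graph of the quadratic function above the straight line through `p` with
  -- direction `(v₁, v₂)`; `e` and `e'` are its velocity and acceleration at `0`.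
  let k : ℝ → ℝ × ℝ × ℝ := fun s => (p.1 + s * v₁, p.2 + s * v₂,
    u + (b * v₁ + a * v₂) * s + (r * v₁ ^ 2 + c * v₂ ^ 2) / 2 * s ^ 2)
  let k' : ℝ → ℝ × ℝ × ℝ := fun s => (v₁, v₂, (b * v₁ + a * v₂) + (r * v₁ ^ 2 + c * v₂ ^ 2) * s)
  have hk : ∀ s, HasDerivAt k (k' s) s := by
    intro s
    refine HasDerivAt.prodMk ?_ (HasDerivAt.prodMk ?_ ?_)
    · simpa using ((hasDerivAt_id s).mul_const v₁).const_add p.1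
    · simpa using ((hasDerivAt_id s).mul_const v₂).const_add p.2
    · have := ((((hasDerivAt_id s).const_mul (b * v₁ + a * v₂)).const_add u).add
        (((hasDerivAt_id s).pow 2).const_mul ((r * v₁ ^ 2 + c * v₂ ^ 2) / 2)))
      refine this.congr_deriv ?_
      simp; ring
  have hk' : HasDerivAt k' e' 0 := by
    refine (hasDerivAt_const _ _).prodMk ((hasDerivAt_const _ _).prodMk ?_)
    simpa using ((hasDerivAt_id (0 : ℝ)).const_mul (r * v₁ ^ 2 + c * v₂ ^ 2)).const_add
      (b * v₁ + a * v₂)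
  have k0 : k 0 = q := by simp [k, q]
  have k'0 : k' 0 = e := by simp [k', e]
  have hg : ContDiffAt ℝ 2 g y := by exact_mod_cast contDiffAt_infty.1 (hlp ▸ h.smooth_g) 2
  have hkl : ∀ s, k s = lift (quadratic p u b a r c) (p.1 + s * v₁, p.2 + s * v₂) := by
    intro s; simp only [k, lift, quadratic, Prod.mk.injEq, true_and]; ring
  have hev : ∀ᶠ s in 𝓝 (0 : ℝ), compU φ (k s) = g (compT φ (k s), compX φ (k s)) := by
    have ht : Tendsto (fun s : ℝ => (p.1 + s * v₁, p.2 + s * v₂)) (𝓝 0) (𝓝 p) := by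
      have : ContinuousAt (fun s : ℝ => (p.1 + s * v₁, p.2 + s * v₂)) 0 := by fun_prop
      simpa [ContinuousAt] using this
    filter_upwards [ht.eventually h.graph] with s hs
    rw [hkl]; exact hs
  have := graph_relation (τ := compT φ) (ξ := compX φ) (υ := compU φ) (g := g) (c := k) (c' := k')
    (c'' := e')
    (by rw [k0]; exact contDiffAt_two_of_contDiffOn φ.open_source hφ.contDiffOn_compT hq)
    (by rw [k0]; exact contDiffAt_two_of_contDiffOn φ.open_source hφ.contDiffOn_compX hq)
    (by rw [k0]; exact contDiffAt_two_of_contDiffOn φ.open_source hφ.contDiffOn_compU hq)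
    (by rw [k0]; exact hg) (Eventually.of_forall hk) hk' hev
  rw [k0, k'0] at this
  exact this

end Prolongation

/-! ### Jets with varying `u_tt`: the new time depends on `t` only. -/

section Necessity

variable {φ : OpenPartialHomeomorph (ℝ × ℝ × ℝ) (ℝ × ℝ × ℝ)} {θ θ' : Coeffs}
  {p : ℝ × ℝ} {u b a r c gt gx : ℝ}

/-- The direction `(-τx, τt)` is chosen because the total derivative of `t̃` along it is zero and
that of `x̃` is `Δ`. The second-order graph relation in this direction therefore contains `g_x̃x̃`
alone, with factor `Δ²`, and the target residual times `Δ²` becomes explicit in the source jet. The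
numbers `gt`, `gx` are forced to be the first derivatives of `g` by the first-order relations. -/
theorem Connects.jet_criterion (hφ : IsPointTransformation φ) (hc : Connects φ θ θ')
    {q : ℝ × ℝ × ℝ} (hqp : q = (p.1, p.2, u)) (hq : q ∈ φ.source)
    {τt τx ξt ξx Δ : ℝ} (hτt : τt = fderiv ℝ (compT φ) q (1, 0, b))
    (hτx : τx = fderiv ℝ (compT φ) q (0, 1, a)) (hξt : ξt = fderiv ℝ (compX φ) q (1, 0, b))
    (hξx : ξx = fderiv ℝ (compX φ) q (0, 1, a)) (hΔ : Δ = τt * ξx - τx * ξt) (hΔ0 : Δ ≠ 0)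
    (hgt : τt * gt + ξt * gx = fderiv ℝ (compU φ) q (1, 0, b))
    (hgx : τx * gt + ξx * gx = fderiv ℝ (compU φ) q (0, 1, a))
    {e : ℝ × ℝ × ℝ} (he : e = (-τx, τt, b * -τx + a * τt)) (r c : ℝ) :
    b + θ.C p * u * a - θ.A2 p * c = 0 ↔
      Δ ^ 2 * (gt + θ'.C (base (φ q)) * compU φ q * gx) = θ'.A2 (base (φ q)) *
        (fderiv ℝ (fderiv ℝ (compU φ)) q e e - gt * fderiv ℝ (fderiv ℝ (compT φ)) q e e -
          gx * fderiv ℝ (fderiv ℝ (compX φ)) q e e +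
          (r * τx ^ 2 + c * τt ^ 2) * (fderiv ℝ (compU φ) q (0, 0, 1) -
            gt * fderiv ℝ (compT φ) q (0, 0, 1) - gx * fderiv ℝ (compX φ) q (0, 0, 1))) := by
  obtain ⟨g, hg⟩ := exists_mapsFunctionAt (r := r) (c := c) hφ (hqp ▸ hq)
    (by rw [← hqp, ← hτt, ← hτx, ← hξt, ← hξx, ← hΔ]; exact hΔ0)
  have hlp : lift (quadratic p u b a r c) p = q := lift_quadratic.trans hqp.symm
  have h1 := (hg.prolongation hφ 1 0).1
  have h2 := (hg.prolongation hφ 0 1).1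
  have h3 := (hg.prolongation hφ (-τx) τt).2
  simp only [mul_one, mul_zero, add_zero, zero_add, ← hqp, ← hτt, ← hξt, ← hτx, ← hξx, ← he]
    at h1 h2 h3
  have hdt : dt g (base (φ q)) = gt := by
    apply mul_left_cancel₀ hΔ0
    rw [hΔ]; linear_combination ξx * (h1 - hgt) - ξt * (h2 - hgx)
  have hdx : dx g (base (φ q)) = gx := by
    apply mul_left_cancel₀ hΔ0
    rw [hΔ]; linear_combination -τx * (h1 - hgt) + τt * (h2 - hgx)
  have heT : fderiv ℝ (compT φ) q e = 0 := by
    rw [fderiv_triple] at hτt hτx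
    rw [he, fderiv_triple]; linear_combination τt * -hτx + τx * hτt
  have heX : fderiv ℝ (compX φ) q e = Δ := by
    rw [fderiv_triple] at hξt hξx
    rw [he, fderiv_triple, hΔ]; linear_combination τt * -hξx + τx * hξt
  have hg2 : ContDiffAt ℝ 2 g (base (φ q)) := by
    have := hg.smooth_g
    rw [hlp] at this
    exact_mod_cast contDiffAt_infty.1 this 2
  have hgq : g (base (φ q)) = compU φ q := by
    have := hg.graph.self_of_nhds
    rw [hlp] at this
    exact this.symm
  have hsm : ∀ k : ℝ, ((0, k) : ℝ × ℝ) = k • (0, 1) := by simp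
  rw [heT, heX, hsm, map_smul, map_smul, smul_apply, ← dx_dx hg2,
    hdt, hdx] at h3
  simp only [smul_eq_mul, fderiv_triple _ _ 0 0 (_ + _)] at h3
  have := hc _ g p hg
  rw [burgersResidual_quadratic, hlp, burgersResidual, hdt, hdx, hgq] at this
  rw [this]
  have hΔ2 : Δ ^ 2 ≠ 0 := pow_ne_zero 2 hΔ0
  constructor
  · intro h
    linear_combination Δ ^ 2 * h + θ'.A2 (base (φ q)) * h3
  · intro h
    apply mul_left_cancel₀ hΔ2
    linear_combination h - θ'.A2 (base (φ q)) * h3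

/-- The factor at the second derivatives in the prolongation does not vanish. -/
theorem IsPointTransformation.transversal (hφ : IsPointTransformation φ) {q : ℝ × ℝ × ℝ}
    (hq : q ∈ φ.source)
    (hgt : fderiv ℝ (compT φ) q (1, 0, b) * gt + fderiv ℝ (compX φ) q (1, 0, b) * gx =
      fderiv ℝ (compU φ) q (1, 0, b))
    (hgx : fderiv ℝ (compT φ) q (0, 1, a) * gt + fderiv ℝ (compX φ) q (0, 1, a) * gx =
      fderiv ℝ (compU φ) q (0, 1, a)) :
    fderiv ℝ (compU φ) q (0, 0, 1) - gt * fderiv ℝ (compT φ) q (0, 0, 1) -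
      gx * fderiv ℝ (compX φ) q (0, 0, 1) ≠ 0 := by
  intro h0
  -- If the factor vanished, `dŨ` would equal `gt dT + gx dX`, contradicting the existence of a
  -- vector on which `dT` and `dX` vanish but `dŨ` is `1`.
  obtain ⟨⟨w1, w2, w3⟩, h1, h2, h3⟩ := hφ.exists_fderiv_eq hq 0 0 1
  rw [fderiv_triple] at h1 h2 h3
  simp only [fderiv_triple _ _ 1 0 b, fderiv_triple _ _ 0 1 a] at hgt hgx
  have : (1 : ℝ) = 0 := by
    linear_combination -h3 + gt * h1 + gx * h2 - w1 * hgt - w2 * hgx + (w3 - w1 * b - w2 * a) * h0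
  exact one_ne_zero this

/-- In the application the two expressions are the Jacobian `D_tT D_xX - D_xT D_tX`, whose terms in
`a * b` cancel, and `D_xT`. If `m₃ ≠ 0`, any `a` can be completed by a suitable `b`; otherwise each
affine function of `a` has at most one root, so one of `0`, `1`, `-1` avoids both. -/
theorem exists_generic_slopes {m₁ m₂ m₃ Tx Tu : ℝ} (hm : ¬(m₁ = 0 ∧ m₂ = 0 ∧ m₃ = 0))
    (hT : ¬(Tx = 0 ∧ Tu = 0)) :
    ∃ a b : ℝ, m₁ + a * m₂ + b * m₃ ≠ 0 ∧ Tx + a * Tu ≠ 0 := by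
  by_contra! H
  have h0 := H 0; have h1 := H 1; have h2 := H (-1)
  by_cases h3 : m₃ = 0
  · subst h3
    have e0 := h0 0; have e1 := h1 0; have e2 := h2 0
    grind
  · have key : ∀ a, Tx + a * Tu = 0 := by
      intro a
      by_contra hne
      have := H a ((1 - m₁ - a * m₂) / m₃) (by field_simp; simp)
      exact hne this
    have e0 := key 0; have e1 := key 1
    grind

theorem exists_solution {x₁ x₂ x₃ x₄ : ℝ} (h : x₁ * x₄ - x₃ * x₂ ≠ 0) (y₁ y₂ : ℝ) :
    ∃ z₁ z₂ : ℝ, x₁ * z₁ + x₂ * z₂ = y₁ ∧ x₃ * z₁ + x₄ * z₂ = y₂ := by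
  refine ⟨(y₁ * x₄ - y₂ * x₂) / (x₁ * x₄ - x₃ * x₂), (x₁ * y₂ - x₃ * y₁) / (x₁ * x₄ - x₃ * x₂),
    ?_, ?_⟩
  · calc _ = y₁ * (x₁ * x₄ - x₃ * x₂) / (x₁ * x₄ - x₃ * x₂) := by ring
      _ = y₁ := mul_div_cancel_right₀ _ h
  · calc _ = y₂ * (x₁ * x₄ - x₃ * x₂) / (x₁ * x₄ - x₃ * x₂) := by ring
      _ = y₂ := mul_div_cancel_right₀ _ h

/-- The source equation does not contain `u_tt`, whereas in the transformed equation `u_tt` enters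
with the coefficient `Ã² (D_xT)²` times the nonzero transversality factor. If `T_x` or `T_u` were
nonzero, a generic slope would make `D_xT ≠ 0`, and comparing `u_tt = 0` with `u_tt = 1` would give
a contradiction. -/
theorem Connects.compT_deriv_eq_zero (hφ : IsPointTransformation φ) (hc : Connects φ θ θ')
    (hA : ∀ y ∈ base '' φ.source, θ.A2 y ≠ 0) (hA' : ∀ y ∈ base '' φ.target, θ'.A2 y ≠ 0)
    {q : ℝ × ℝ × ℝ} (hq : q ∈ φ.source) :
    fderiv ℝ (compT φ) q (0, 1, 0) = 0 ∧ fderiv ℝ (compT φ) q (0, 0, 1) = 0 := by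
  by_contra hne
  obtain ⟨⟨w1, w2, w3⟩, h1, h2, -⟩ := hφ.exists_fderiv_eq hq 1 0 0
  obtain ⟨⟨z1, z2, z3⟩, h3, h4, -⟩ := hφ.exists_fderiv_eq hq 0 1 0
  rw [fderiv_triple] at h1 h2 h3 h4
  obtain ⟨a, b, hab, hτ⟩ := exists_generic_slopes
    (m₁ := fderiv ℝ (compT φ) q (1, 0, 0) * fderiv ℝ (compX φ) q (0, 1, 0) -
      fderiv ℝ (compT φ) q (0, 1, 0) * fderiv ℝ (compX φ) q (1, 0, 0))
    (m₂ := fderiv ℝ (compT φ) q (1, 0, 0) * fderiv ℝ (compX φ) q (0, 0, 1) -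
      fderiv ℝ (compT φ) q (0, 0, 1) * fderiv ℝ (compX φ) q (1, 0, 0))
    (m₃ := fderiv ℝ (compT φ) q (0, 0, 1) * fderiv ℝ (compX φ) q (0, 1, 0) -
      fderiv ℝ (compT φ) q (0, 1, 0) * fderiv ℝ (compX φ) q (0, 0, 1))
    (by
      rintro ⟨e1, e2, e3⟩
      apply one_ne_zero (α := ℝ)
      have hd : (w1 * fderiv ℝ (compT φ) q (1, 0, 0) + w2 * fderiv ℝ (compT φ) q (0, 1, 0) +
          w3 * fderiv ℝ (compT φ) q (0, 0, 1)) * (z1 * fderiv ℝ (compX φ) q (1, 0, 0) +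
          z2 * fderiv ℝ (compX φ) q (0, 1, 0) + z3 * fderiv ℝ (compX φ) q (0, 0, 1)) -
          (z1 * fderiv ℝ (compT φ) q (1, 0, 0) + z2 * fderiv ℝ (compT φ) q (0, 1, 0) +
          z3 * fderiv ℝ (compT φ) q (0, 0, 1)) * (w1 * fderiv ℝ (compX φ) q (1, 0, 0) +
          w2 * fderiv ℝ (compX φ) q (0, 1, 0) + w3 * fderiv ℝ (compX φ) q (0, 0, 1)) = 1 := by
        rw [h1, h2, h3, h4]; ring
      rw [← hd]
      linear_combination (w1 * z2 - w2 * z1) * e1 + (w1 * z3 - w3 * z1) * e2 +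
        (w3 * z2 - w2 * z3) * e3)
    hne
  set q' : ℝ × ℝ := (q.1, q.2.1)
  have hΔ0 : fderiv ℝ (compT φ) q (1, 0, b) * fderiv ℝ (compX φ) q (0, 1, a) -
      fderiv ℝ (compT φ) q (0, 1, a) * fderiv ℝ (compX φ) q (1, 0, b) ≠ 0 := by
    simp only [fderiv_triple _ _ 1 0 b, fderiv_triple _ _ 0 1 a]
    convert! hab using 1; ring
  have hτ' : fderiv ℝ (compT φ) q (0, 1, a) ≠ 0 := by
    rw [fderiv_triple]; convert! hτ using 1; ring
  obtain ⟨gt, gx, hgt, hgx⟩ := exists_solution hΔ0 (fderiv ℝ (compU φ) q (1, 0, b))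
    (fderiv ℝ (compU φ) q (0, 1, a))
  have hA0 := hA q' ⟨q, hq, rfl⟩
  have crit := hc.jet_criterion hφ (p := q') (u := q.2.2) rfl hq rfl rfl rfl rfl rfl hΔ0 hgt hgx rfl
  have k0 := (crit 0 ((b + θ.C q' * q.2.2 * a) / θ.A2 q')).1 (by field_simp; ring)
  have k1 := (crit 1 ((b + θ.C q' * q.2.2 * a) / θ.A2 q')).1 (by field_simp; ring)
  have hlam := hφ.transversal hq hgt hgx
  have hA1 := hA' (base (φ q)) ⟨φ q, φ.map_source hq, rfl⟩
  refine mul_ne_zero (mul_ne_zero hA1 (pow_ne_zero 2 hτ')) hlam ?_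
  linear_combination k0 - k1

end Necessity

/-! ### Jets with varying `u_xx` and `u_x`: `X_u = 0` and `U_uu = 0`. -/

section Necessity

variable {φ : OpenPartialHomeomorph (ℝ × ℝ × ℝ) (ℝ × ℝ × ℝ)} {θ θ' : Coeffs}
  {p : ℝ × ℝ} {u b a r c gt gx : ℝ}

theorem IsPointTransformation.compT_dt_ne_zero (hφ : IsPointTransformation φ) {q : ℝ × ℝ × ℝ}
    (hq : q ∈ φ.source) (hT : fderiv ℝ (compT φ) q (0, 1, 0) = 0 ∧
      fderiv ℝ (compT φ) q (0, 0, 1) = 0) : fderiv ℝ (compT φ) q (1, 0, 0) ≠ 0 := by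
  intro h0
  obtain ⟨⟨w1, w2, w3⟩, h, -, -⟩ := hφ.exists_fderiv_eq hq 1 0 0
  rw [fderiv_triple, hT.1, hT.2, h0] at h
  simp at h

theorem Connects.jet_criterion_of_fiberPreserving (hφ : IsPointTransformation φ)
    (hc : Connects φ θ θ') (hT : ∀ q ∈ φ.source, fderiv ℝ (compT φ) q (0, 1, 0) = 0 ∧
      fderiv ℝ (compT φ) q (0, 0, 1) = 0)
    {q : ℝ × ℝ × ℝ} (hqp : q = (p.1, p.2, u)) (hq : q ∈ φ.source)
    (hξ : fderiv ℝ (compX φ) q (0, 1, a) ≠ 0)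
    (hgx : fderiv ℝ (compX φ) q (0, 1, a) * gx = fderiv ℝ (compU φ) q (0, 1, a)) (b c : ℝ) :
    b + θ.C p * u * a - θ.A2 p * c = 0 ↔
      fderiv ℝ (compX φ) q (0, 1, a) ^ 2 *
          (fderiv ℝ (compU φ) q (1, 0, b) - gx * fderiv ℝ (compX φ) q (1, 0, b) +
            fderiv ℝ (compT φ) q (1, 0, 0) * θ'.C (base (φ q)) * compU φ q * gx) =
        θ'.A2 (base (φ q)) * fderiv ℝ (compT φ) q (1, 0, 0) *
          (fderiv ℝ (fderiv ℝ (compU φ)) q (0, 1, a) (0, 1, a) -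
            gx * fderiv ℝ (fderiv ℝ (compX φ)) q (0, 1, a) (0, 1, a) +
            c * (fderiv ℝ (compU φ) q (0, 0, 1) - gx * fderiv ℝ (compX φ) q (0, 0, 1))) := by
  have ht0 := hφ.compT_dt_ne_zero hq (hT q hq)
  set t := fderiv ℝ (compT φ) q (1, 0, 0) with ht
  have e1 : t = fderiv ℝ (compT φ) q (1, 0, b) := by
    rw [fderiv_triple, (hT q hq).1, (hT q hq).2, ht]; ring
  have e2 : 0 = fderiv ℝ (compT φ) q (0, 1, a) := by
    rw [fderiv_triple, (hT q hq).1, (hT q hq).2]; ring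
  have hTT : fderiv ℝ (fderiv ℝ (compT φ)) q (0, 1, a) (0, 1, a) = 0 := by
    rw [← dir_dir (contDiffAt_two_of_contDiffOn φ.open_source hφ.contDiffOn_compT hq)]
    have : (fun q' => fderiv ℝ (compT φ) q' (0, 1, a)) =ᶠ[𝓝 q] fun _ => 0 := by
      filter_upwards [φ.open_source.mem_nhds hq] with q' hq'
      rw [fderiv_triple, (hT q' hq').1, (hT q' hq').2]; ring
    rw [this.fderiv_eq]; simp
  set ξx := fderiv ℝ (compX φ) q (0, 1, a)
  set ξt := fderiv ℝ (compX φ) q (1, 0, b)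
  obtain ⟨gt, hgt⟩ : ∃ gt, t * gt = fderiv ℝ (compU φ) q (1, 0, b) - gx * ξt :=
    ⟨_, mul_div_cancel₀ _ ht0⟩
  -- Since `D_xT = 0`, the distinguished direction is a multiple of `(0, 1, a)` and the value chosen
  -- for `u_tt` (here `0`) does not matter.
  have crit := hc.jet_criterion hφ hqp hq (b := b) (a := a) (Δ := t * ξx)
    (gt := gt) (gx := gx) e1 e2 rfl rfl (by ring)
    (mul_ne_zero ht0 hξ) (by rw [hgt]; ring) (by rw [zero_mul, zero_add]; exact hgx)
    (e := t • (0, 1, a)) (by simp; ring) 0 c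
  rw [crit]
  simp only [map_smul, smul_apply, smul_eq_mul, hTT, (hT q hq).2]
  constructor
  · intro h
    apply mul_left_cancel₀ (pow_ne_zero 2 ht0)
    linear_combination t * h - t ^ 2 * ξx ^ 2 * hgt
  · intro h
    apply mul_left_cancel₀ ht0
    linear_combination t ^ 2 * h + t ^ 2 * ξx ^ 2 * hgt

/-- Raising `u_xx` by `1` and `u_t` by `A²` preserves the source equation; the change in the target
equation gives `A² (D_xX)² = Ã² T_t` for every slope with `D_xX ≠ 0`. The right-hand side does not
depend on the slope, so `D_xX` cannot vary with it, that is, `X_u = 0`. -/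
theorem Connects.compX_deriv (hφ : IsPointTransformation φ)
    (hc : Connects φ θ θ') (hA : ∀ y ∈ base '' φ.source, θ.A2 y ≠ 0)
    (hT : ∀ q ∈ φ.source, fderiv ℝ (compT φ) q (0, 1, 0) = 0 ∧
      fderiv ℝ (compT φ) q (0, 0, 1) = 0)
    {q : ℝ × ℝ × ℝ} (hq : q ∈ φ.source) :
    fderiv ℝ (compX φ) q (0, 0, 1) = 0 ∧ fderiv ℝ (compX φ) q (0, 1, 0) ≠ 0 ∧
      θ.A2 (base q) * fderiv ℝ (compX φ) q (0, 1, 0) ^ 2 =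
        θ'.A2 (base (φ q)) * fderiv ℝ (compT φ) q (1, 0, 0) := by
  have hA0 := hA (base q) ⟨q, hq, rfl⟩
  have key : ∀ a, fderiv ℝ (compX φ) q (0, 1, a) ≠ 0 →
      θ.A2 (base q) * fderiv ℝ (compX φ) q (0, 1, a) ^ 2 =
        θ'.A2 (base (φ q)) * fderiv ℝ (compT φ) q (1, 0, 0) := by
    intro a ha
    obtain ⟨gx, hgx⟩ : ∃ gx, fderiv ℝ (compX φ) q (0, 1, a) * gx = fderiv ℝ (compU φ) q (0, 1, a) :=
      ⟨_, mul_div_cancel₀ _ ha⟩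
    have crit := hc.jet_criterion_of_fiberPreserving hφ hT (q := q) (p := base q) (u := q.2.2) rfl hq ha hgx
    have k0 := (crit (-θ.C (base q) * q.2.2 * a) 0).1 (by ring)
    have k1 := (crit (θ.A2 (base q) - θ.C (base q) * q.2.2 * a) 1).1 (by ring)
    have ht0 := hφ.compT_dt_ne_zero hq (hT q hq)
    have hlam : fderiv ℝ (compU φ) q (0, 0, 1) - gx * fderiv ℝ (compX φ) q (0, 0, 1) ≠ 0 := by
      have := hφ.transversal hq (b := 0) (a := a) (gx := gx) (gt := (fderiv ℝ (compU φ) q (1, 0, 0)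
        - fderiv ℝ (compX φ) q (1, 0, 0) * gx) / fderiv ℝ (compT φ) q (1, 0, 0))
        (by field_simp; ring) (by rw [fderiv_triple _ _ 0 1 a, (hT q hq).1, (hT q hq).2, ← hgx]; ring)
      rwa [(hT q hq).2, mul_zero, sub_zero] at this
    apply mul_left_cancel₀ hlam
    rw [fderiv_triple (compU φ) q 1 0, fderiv_triple (compX φ) q 1 0] at k0 k1
    linear_combination k1 - k0
  have hXu : fderiv ℝ (compX φ) q (0, 0, 1) = 0 := by
    by_contra hne
    have hval : ∀ k, fderiv ℝ (compX φ) q (0, 1, (k - fderiv ℝ (compX φ) q (0, 1, 0)) /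
        fderiv ℝ (compX φ) q (0, 0, 1)) = k := by
      intro k; rw [fderiv_triple]; field_simp; ring
    -- With `X_u ≠ 0` the slope could be tuned to make `D_xX` equal to `1` and to `2`, whence `A² =
    -- 4 A²`.
    have k1 := key _ (by rw [hval 1]; norm_num)
    have k2 := key _ (by rw [hval 2]; norm_num)
    rw [hval] at k1 k2
    exact hA0 (by linear_combination (k2 - k1) / 3)
  have hXx : fderiv ℝ (compX φ) q (0, 1, 0) ≠ 0 := by
    intro h0
    obtain ⟨⟨w1, w2, w3⟩, h1, h2, -⟩ := hφ.exists_fderiv_eq hq 0 1 0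
    have ht0 := hφ.compT_dt_ne_zero hq (hT q hq)
    rw [fderiv_triple, (hT q hq).1, (hT q hq).2] at h1
    rw [fderiv_triple, hXu, h0] at h2
    have : w1 = 0 := by simpa [ht0] using h1
    simp [this] at h2
  exact ⟨hXu, hXx, key 0 hXx⟩

/-- On source jets with `u_xx = 0` and `u_t = -C u u_x`, every term of the transformed equation is
affine in the slope `a` except `Ã² T_t U_uu a²`. The second difference over the slopes `0`, `1`,
`-1` isolates that term. -/
theorem Connects.compU_du_du (hφ : IsPointTransformation φ)
    (hc : Connects φ θ θ') (hA' : ∀ y ∈ base '' φ.target, θ'.A2 y ≠ 0)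
    (hT : ∀ q ∈ φ.source, fderiv ℝ (compT φ) q (0, 1, 0) = 0 ∧
      fderiv ℝ (compT φ) q (0, 0, 1) = 0)
    (hX : ∀ q ∈ φ.source, fderiv ℝ (compX φ) q (0, 0, 1) = 0 ∧ fderiv ℝ (compX φ) q (0, 1, 0) ≠ 0)
    {q : ℝ × ℝ × ℝ} (hq : q ∈ φ.source) :
    fderiv ℝ (fderiv ℝ (compU φ)) q (0, 0, 1) (0, 0, 1) = 0 := by
  have hA1 := hA' (base (φ q)) ⟨φ q, φ.map_source hq, rfl⟩
  have ht0 := hφ.compT_dt_ne_zero hq (hT q hq)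
  have hξ : ∀ a, fderiv ℝ (compX φ) q (0, 1, a) = fderiv ℝ (compX φ) q (0, 1, 0) := by
    intro a; rw [fderiv_triple, (hX q hq).1]; ring
  have hX2 : ContDiffAt ℝ 2 (compX φ) q :=
    contDiffAt_two_of_contDiffOn φ.open_source hφ.contDiffOn_compX hq
  have hXu : ∀ w, fderiv ℝ (fderiv ℝ (compX φ)) q w (0, 0, 1) = 0 := by
    intro w
    rw [← dir_dir hX2]
    have : (fun q' => fderiv ℝ (compX φ) q' (0, 0, 1)) =ᶠ[𝓝 q] fun _ => 0 := by
      filter_upwards [φ.open_source.mem_nhds hq] with q' hq'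
      exact (hX q' hq').1
    rw [this.fderiv_eq]; simp
  have hsum : ∀ a : ℝ, ((0, 1, a) : ℝ × ℝ × ℝ) = (0, 1, 0) + a • (0, 0, 1) := by simp
  have hXX : ∀ a, fderiv ℝ (fderiv ℝ (compX φ)) q (0, 1, a) (0, 1, a) =
      fderiv ℝ (fderiv ℝ (compX φ)) q (0, 1, 0) (0, 1, 0) := by
    intro a
    rw [hsum, map_add, map_smul, hXu, fderiv_fderiv_symm hX2, map_add, map_smul, hXu]; simp
  have hUU : ∀ a, fderiv ℝ (fderiv ℝ (compU φ)) q (0, 1, a) (0, 1, a) =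
      fderiv ℝ (fderiv ℝ (compU φ)) q (0, 1, 0) (0, 1, 0) +
      a * (fderiv ℝ (fderiv ℝ (compU φ)) q (0, 1, 0) (0, 0, 1) +
        fderiv ℝ (fderiv ℝ (compU φ)) q (0, 0, 1) (0, 1, 0)) +
      a ^ 2 * fderiv ℝ (fderiv ℝ (compU φ)) q (0, 0, 1) (0, 0, 1) := by
    intro a
    rw [hsum]; simp only [map_add, map_smul, add_apply, smul_apply, smul_eq_mul]; ring
  set x := fderiv ℝ (compX φ) q (0, 1, 0)
  have crit : ∀ a, _ := fun a =>
    ((hc.jet_criterion_of_fiberPreserving hφ hT (q := q) (p := base q) (u := q.2.2) (a := a)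
      (gx := fderiv ℝ (compU φ) q (0, 1, a) / x) rfl hq (by rw [hξ]; exact (hX q hq).2)
      (by rw [hξ]; exact mul_div_cancel₀ _ (hX q hq).2)) (-θ.C (base q) * q.2.2 * a) 0).1 (by ring)
  have k0 := crit 0
  have k1 := crit 1
  have k2 := crit (-1)
  simp only [hξ 1, hξ (-1), hXX 1, hXX (-1), hUU 1, hUU (-1), fderiv_triple _ _ 1 0 (_ * _),
    fderiv_triple (compU φ) q 0 1 1, fderiv_triple (compU φ) q 0 1 (-1), (hX q hq).1] at k0 k1 k2
  have hne : 2 * (θ'.A2 (base (φ q)) * fderiv ℝ (compT φ) q (1, 0, 0)) ≠ 0 := by positivity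
  apply mul_left_cancel₀ hne
  linear_combination 2 * k0 - k1 - k2

end Necessity

/-! ### Functions on `Ω` that descend to `(t, x)` or to `t`. -/

section Descent

variable {Ω : Set (ℝ × ℝ × ℝ)} {F : ℝ × ℝ × ℝ → ℝ}

theorem continuous_base : Continuous base := by unfold base; fun_prop

theorem isOpen_base_image (hΩ : IsOpen Ω) : IsOpen (base '' Ω) :=
  (IsOpenMap.id.prodMap isOpenMap_fst : IsOpenMap (Prod.map id Prod.fst)) Ω hΩ

theorem isOpen_fst_image (hΩ : IsOpen Ω) : IsOpen (Prod.fst '' Ω) := isOpenMap_fst Ω hΩ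

theorem exists_lift_mem {p : ℝ × ℝ} (hp : p ∈ base '' Ω) : ∃ u, (p.1, p.2, u) ∈ Ω := by
  obtain ⟨q, hq, rfl⟩ := hp
  exact ⟨q.2.2, hq⟩

/-- A function on `Ω` with vanishing `u`-derivative is a function of `(t, x)`. -/
theorem exists_eq_comp_base (hΩ : IsOpen Ω)
    (hs : ∀ t x : ℝ, IsPreconnected {u : ℝ | (t, x, u) ∈ Ω}) (hF : ContDiffOn ℝ ∞ F Ω)
    (h0 : ∀ q ∈ Ω, fderiv ℝ F q (0, 0, 1) = 0) :
    ∃ G : ℝ × ℝ → ℝ, ContDiffOn ℝ ∞ G (base '' Ω) ∧ ∀ q ∈ Ω, F q = G (base q) := by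
  choose! k hk using fun (p : ℝ × ℝ) (hp : p ∈ base '' Ω) => exists_lift_mem hp
  have hconst : ∀ t x u v, (t, x, u) ∈ Ω → (t, x, v) ∈ Ω → F (t, x, u) = F (t, x, v) := by
    intro t x u v hu hv
    have hline : ∀ s, HasDerivAt (fun s : ℝ => ((t, x, s) : ℝ × ℝ × ℝ)) (0, 0, 1) s := fun s =>
      (hasDerivAt_const _ _).prodMk ((hasDerivAt_const _ _).prodMk (hasDerivAt_id _))
    have hd : ∀ s ∈ {s : ℝ | (t, x, s) ∈ Ω}, HasDerivAt (fun s => F (t, x, s)) 0 s := by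
      intro s hs
      have := (differentiableAt_of_contDiffOn hΩ hF hs).hasFDerivAt.comp_hasDerivAt s (hline s)
      rwa [h0 _ hs] at this
    exact (hΩ.preimage (by fun_prop : Continuous fun s : ℝ => (t, x, s))).is_const_of_deriv_eq_zero
      (f := fun s => F (t, x, s)) (hs t x)
      (fun s hs => (hd s hs).differentiableAt.differentiableWithinAt) (fun s hs => (hd s hs).deriv)
      hu hv
  -- The choice `k` of a height need not be continuous: by constancy along the fibres it can be
  -- replaced locally by a fixed height, which gives smoothness.
  refine ⟨fun p => F (p.1, p.2, k p), ?_, fun q hq => hconst _ _ _ _ hq (hk _ ⟨q, hq, rfl⟩)⟩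
  rintro _ ⟨q, hq, rfl⟩
  have hmem : ∀ᶠ p in 𝓝 (base q), (p.1, p.2, q.2.2) ∈ Ω :=
    (by fun_prop : Continuous fun p : ℝ × ℝ => (p.1, p.2, q.2.2)).continuousAt.eventually
      (hΩ.mem_nhds hq)
  have h1 : ContDiffAt ℝ ∞ (fun p : ℝ × ℝ => F (p.1, p.2, q.2.2)) (base q) :=
    ContDiffAt.comp (g := F) _ (hF.contDiffAt (hΩ.mem_nhds hq))
      (contDiff_fst.prodMk (contDiff_snd.prodMk contDiff_const)).contDiffAt
  refine (h1.congr_of_eventuallyEq ?_).contDiffWithinAt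
  filter_upwards [hmem] with p hp
  exact hconst _ _ _ _ (hk p ⟨_, hp, rfl⟩) hp

/-- A function on `Ω` with vanishing `x`- and `u`-derivatives is a function of `t`. -/
theorem exists_eq_comp_fst (hΩ : IsOpen Ω)
    (hs : ∀ t : ℝ, IsPreconnected {z : ℝ × ℝ | (t, z.1, z.2) ∈ Ω}) (hF : ContDiffOn ℝ ∞ F Ω)
    (h0 : ∀ q ∈ Ω, fderiv ℝ F q (0, 1, 0) = 0 ∧ fderiv ℝ F q (0, 0, 1) = 0) :
    ∃ G : ℝ → ℝ, ContDiffOn ℝ ∞ G (Prod.fst '' Ω) ∧ ∀ q ∈ Ω, F q = G q.1 := by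
  have hex : ∀ t ∈ Prod.fst '' Ω, ∃ z : ℝ × ℝ, (t, z) ∈ Ω := by
    rintro _ ⟨q, hq, rfl⟩
    exact ⟨q.2, hq⟩
  choose! k hk using hex
  have hconst : ∀ t y z, (t, y) ∈ Ω → (t, z) ∈ Ω → F (t, y) = F (t, z) := by
    intro t y z hy hz
    have hline : ∀ z : ℝ × ℝ, HasFDerivAt (fun z : ℝ × ℝ => ((t, z) : ℝ × ℝ × ℝ))
        (ContinuousLinearMap.inr ℝ ℝ (ℝ × ℝ)) z := fun z =>
      hasFDerivAt_prodMk_right (𝕜 := ℝ) t z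
    have hd : ∀ z ∈ {z : ℝ × ℝ | (t, z) ∈ Ω}, 
        HasFDerivAt (fun z : ℝ × ℝ => F (t, z)) (0 : ℝ × ℝ →L[ℝ] ℝ) z := by
      intro z hz
      have := HasFDerivAt.comp (g := F) z (differentiableAt_of_contDiffOn hΩ hF hz).hasFDerivAt
        (hline z)
      refine this.congr_fderiv ?_
      ext <;> simp [h0 _ hz]
    exact (hΩ.preimage (by fun_prop : Continuous fun z : ℝ × ℝ => (t, z))).is_const_of_fderiv_eq_zero
      (f := fun z => F (t, z)) (𝕜 := ℝ) (hs t)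
      (fun s hs => (hd s hs).differentiableAt.differentiableWithinAt) (fun s hs => (hd s hs).fderiv)
      hy hz
  refine ⟨fun t => F (t, k t), ?_, fun q hq => hconst _ _ _ hq (hk _ ⟨q, hq, rfl⟩)⟩
  rintro _ ⟨q, hq, rfl⟩
  have hmem : ∀ᶠ t in 𝓝 q.1, (t, q.2) ∈ Ω :=
    (by fun_prop : Continuous fun t : ℝ => (t, q.2)).continuousAt.eventually (hΩ.mem_nhds hq)
  have h1 : ContDiffAt ℝ ∞ (fun t : ℝ => F (t, q.2)) q.1 :=
    ContDiffAt.comp (g := F) _ (hF.contDiffAt (hΩ.mem_nhds hq))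
      (contDiff_id.prodMk contDiff_const).contDiffAt
  refine (h1.congr_of_eventuallyEq ?_).contDiffWithinAt
  filter_upwards [hmem] with t ht
  exact hconst _ _ _ (hk t ⟨_, ht, rfl⟩) ht

theorem fderiv_comp_base {G : ℝ × ℝ → ℝ} {q : ℝ × ℝ × ℝ} (hG : DifferentiableAt ℝ G (base q))
    (h : F =ᶠ[𝓝 q] fun q => G (base q)) (a b c : ℝ) :
    fderiv ℝ F q (a, b, c) = a * dt G (base q) + b * dx G (base q) := by
  have hb : HasFDerivAt base ((ContinuousLinearMap.fst ℝ ℝ (ℝ × ℝ)).prod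
      ((ContinuousLinearMap.fst ℝ ℝ ℝ).comp (ContinuousLinearMap.snd ℝ ℝ (ℝ × ℝ)))) q :=
    hasFDerivAt_fst.prodMk (hasFDerivAt_fst.comp q hasFDerivAt_snd)
  have hGb : HasFDerivAt (fun q => G (base q)) _ q := hG.hasFDerivAt.comp q hb
  rw [h.fderiv_eq, hGb.fderiv, ← fderiv_pair]
  rfl

theorem fderiv_comp_fst {E : Type*} [NormedAddCommGroup E] [NormedSpace ℝ E] {F : ℝ × E → ℝ}
    {G : ℝ → ℝ} {q : ℝ × E} (hG : DifferentiableAt ℝ G q.1)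
    (h : F =ᶠ[𝓝 q] fun q => G q.1) (v : ℝ × E) : fderiv ℝ F q v = deriv G q.1 * v.1 := by
  have : HasFDerivAt (fun q : ℝ × E => G q.1) _ q := 
    HasDerivAt.comp_hasFDerivAt (f := fun q : ℝ × E => q.1) q hG.hasDerivAt
      (hasFDerivAt_fst (𝕜 := ℝ) (p := q))
  rw [h.fderiv_eq, this.fderiv]
  simp

end Descent

/-! ### Chain rule for `(T(t), X(t, x))` and polynomial splitting. -/

section ChainRule

/-- The chain rule for the change `t̃ = T(t)`, `x̃ = X(t, x)` of the independent variables. -/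
theorem chain_rule {T : ℝ → ℝ} {X g h : ℝ × ℝ → ℝ} {p : ℝ × ℝ} (hT : ContDiffAt ℝ ∞ T p.1)
    (hX : ContDiffAt ℝ 2 X p) (hg : ContDiffAt ℝ 2 g (T p.1, X p)) (hh : ContDiffAt ℝ 2 h p)
    (hgh : ∀ᶠ q in 𝓝 p, h q = g (T q.1, X q)) :
    deriv T p.1 * dt g (T p.1, X p) + dt X p * dx g (T p.1, X p) = dt h p ∧
      dx X p * dx g (T p.1, X p) = dx h p ∧
      dx X p ^ 2 * dx (dx g) (T p.1, X p) + dx (dx X) p * dx g (T p.1, X p) = dx (dx h) p := by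
  set τ : ℝ × ℝ → ℝ := fun q => T q.1 with hτdef
  have hτ : ContDiffAt ℝ ∞ τ p := ContDiffAt.comp p hT contDiffAt_fst
  have hτ2 : ContDiffAt ℝ 2 τ p := by exact_mod_cast contDiffAt_infty.1 hτ 2
  have hτd : ∀ᶠ q in 𝓝 p, ∀ v, fderiv ℝ τ q v = deriv T q.1 * v.1 := by
    have h1 : ∀ᶠ t in 𝓝 p.1, ContDiffAt ℝ 1 T t :=
      (hT.of_le (by simp) : ContDiffAt ℝ 1 T p.1).eventually (by simp)
    filter_upwards [continuousAt_fst.eventually h1] with q hq v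
    exact fderiv_comp_fst (hq.differentiableAt (by simp)) (Eventually.of_forall fun _ => rfl) v
  have hτ0 := hτd.self_of_nhds
  have hττ : fderiv ℝ (fderiv ℝ τ) p (0, 1) (0, 1) = 0 := by
    rw [← dir_dir hτ2]
    have : (fun q => fderiv ℝ τ q (0, 1)) =ᶠ[𝓝 p] fun _ => 0 := by
      filter_upwards [hτd] with q hq
      rw [hq]; simp
    rw [this.fderiv_eq]; simp
  have key : ∀ v : ℝ × ℝ, _ := fun v => graph_relation (τ := τ) (ξ := X) (υ := h) (g := g)
    (c := fun s => p + s • v) (c' := fun _ => v) (c'' := 0) (by simpa using hτ2)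
    (by simpa using hX) (by simpa using hh) (by simpa [hτdef] using hg)
    (Eventually.of_forall fun s => by
      simpa using ((hasDerivAt_id s).smul_const v).const_add p)
    (hasDerivAt_const _ _)
    (by
      have : Tendsto (fun s : ℝ => p + s • v) (𝓝 0) (𝓝 p) := by
        have : ContinuousAt (fun s : ℝ => p + s • v) 0 := by fun_prop
        simpa [ContinuousAt] using this
      exact this.eventually hgh)
  have k1 := key (1, 0)
  have k2 := key (0, 1)
  simp only [zero_smul, add_zero, map_zero, hτ0, mul_one, mul_zero, zero_mul, zero_add, hττ, Prod.fst_zero,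
    show τ p = T p.1 from rfl] at k1 k2
  have hsm : ∀ k : ℝ, ((0, k) : ℝ × ℝ) = k • (0, 1) := by simp
  refine ⟨k1.1, k2.1, ?_⟩
  have := k2.2
  rw [dx_dx hg, dx_dx hX, dx_dx hh]
  rw [hsm (fderiv ℝ X p (0, 1)), map_smul, map_smul, smul_apply, smul_eq_mul, smul_eq_mul] at this
  rw [← this, dx]
  ring

theorem coeff_eq_zero_of_eventually {α β γ u : ℝ}
    (h : ∀ᶠ v in 𝓝 u, α * v ^ 2 + β * v + γ = 0) : α = 0 ∧ β = 0 ∧ γ = 0 := by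
  obtain ⟨ε, hε, hb⟩ := Metric.eventually_nhds_iff.1 h
  have h0 := hb (y := u) (by simpa using hε)
  have h1 := hb (y := u + ε / 2) (by simp [abs_of_pos hε]; linarith)
  have h2 := hb (y := u - ε / 2) (by simp [abs_of_pos hε]; linarith)
  have hα : α = 0 := by
    have : ε ^ 2 / 2 * α = 0 := by linear_combination h1 + h2 - 2 * h0
    exact (mul_eq_zero.1 this).resolve_left (by positivity)
  subst hα
  have hβ : β = 0 := by
    have : ε * β = 0 := by linear_combination h1 - h2
    exact (mul_eq_zero.1 this).resolve_left hε.ne'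
  subst hβ
  exact ⟨rfl, rfl, by linear_combination h0⟩

end ChainRule

/-! ### Affine dependence on `u` and the resulting determining identity. -/

section Determining

variable {φ : OpenPartialHomeomorph (ℝ × ℝ × ℝ) (ℝ × ℝ × ℝ)} {θ θ' : Coeffs}

/-- `φ` has the form `t̃ = T(t)`, `x̃ = X(t, x)`, `ũ = U¹(t, x) u + U⁰(t, x)`. -/
structure IsFiberAffine (φ : OpenPartialHomeomorph (ℝ × ℝ × ℝ) (ℝ × ℝ × ℝ))
    (T : ℝ → ℝ) (X U1 U0 : ℝ × ℝ → ℝ) : Prop where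
  smooth_T : ContDiffOn ℝ ∞ T (Prod.fst '' φ.source)
  smooth_X : ContDiffOn ℝ ∞ X (base '' φ.source)
  smooth_U1 : ContDiffOn ℝ ∞ U1 (base '' φ.source)
  smooth_U0 : ContDiffOn ℝ ∞ U0 (base '' φ.source)
  components : ∀ q ∈ φ.source, φ q = (T q.1, X (base q), U1 (base q) * q.2.2 + U0 (base q))
  deriv_ne_zero : ∀ p ∈ base '' φ.source, deriv T p.1 ≠ 0
  dx_ne_zero : ∀ p ∈ base '' φ.source, dx X p ≠ 0
  ne_zero : ∀ p ∈ base '' φ.source, U1 p ≠ 0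

theorem fst_mem_of_mem_base {p : ℝ × ℝ} (hp : p ∈ base '' φ.source) :
    p.1 ∈ Prod.fst '' φ.source := by
  obtain ⟨q, hq, rfl⟩ := hp
  exact ⟨q, hq, rfl⟩

theorem Connects.isFiberAffine (hφ : IsPointTransformation φ) (hΩ : HasConnectedSlices φ.source)
    (hc : Connects φ θ θ') (hA : ∀ y ∈ base '' φ.source, θ.A2 y ≠ 0)
    (hA' : ∀ y ∈ base '' φ.target, θ'.A2 y ≠ 0) :
    ∃ (T : ℝ → ℝ) (X U1 U0 : ℝ × ℝ → ℝ), IsFiberAffine φ T X U1 U0 ∧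
      ∀ p ∈ base '' φ.source,
        θ.A2 p * dx X p ^ 2 = θ'.A2 (T p.1, X p) * deriv T p.1 := by
  have hT := fun q hq => hc.compT_deriv_eq_zero hφ hA hA' (q := q) hq
  have hX := fun q hq => hc.compX_deriv hφ hA hT (q := q) hq
  have hU := fun q hq => hc.compU_du_du hφ hA' hT
    (fun q hq => ⟨(hX q hq).1, (hX q hq).2.1⟩) (q := q) hq
  have hso := φ.open_source
  have hD := isOpen_base_image hso
  obtain ⟨T, hTs, hTe⟩ := exists_eq_comp_fst hso hΩ.slice_t hφ.contDiffOn_compT hT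
  obtain ⟨X, hXs, hXe⟩ := exists_eq_comp_base hso hΩ.slice_tx hφ.contDiffOn_compX
    fun q hq => (hX q hq).1
  have hUs : ContDiffOn ℝ ∞ (fun q => fderiv ℝ (compU φ) q (0, 0, 1)) φ.source :=
    (hφ.contDiffOn_compU.fderiv_of_isOpen hso (m := ∞) (by simp)).clm_apply contDiffOn_const
  -- `U1` is the `u`-derivative of the third component, a function of `(t, x)` because `U_uu = 0`;
  -- below, `U0` is what remains after subtracting `U1 * u`.
  obtain ⟨U1, hU1s, hU1e⟩ := exists_eq_comp_base hso hΩ.slice_tx hUs fun q hq => by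
    rw [dir_dir (contDiffAt_two_of_contDiffOn hso hφ.contDiffOn_compU hq)]; exact hU q hq
  have hb : ContDiffOn ℝ ∞ base φ.source :=
    (contDiff_fst.prodMk (contDiff_fst.comp contDiff_snd)).contDiffOn
  have hU1b : ContDiffOn ℝ ∞ (fun q => U1 (base q)) φ.source := hU1s.comp hb (mapsTo_image _ _)
  have hu : ContDiff ℝ ∞ (fun q : ℝ × ℝ × ℝ => q.2.2) := contDiff_snd.comp contDiff_snd
  obtain ⟨U0, hU0s, hU0e⟩ := exists_eq_comp_base hso hΩ.slice_tx
    (F := fun q => compU φ q - U1 (base q) * q.2.2)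
    (hφ.contDiffOn_compU.sub (hU1b.mul hu.contDiffOn)) fun q hq => by
      have hu' : HasFDerivAt (fun q : ℝ × ℝ × ℝ => q.2.2) ((ContinuousLinearMap.snd ℝ ℝ ℝ).comp
        (ContinuousLinearMap.snd ℝ ℝ (ℝ × ℝ))) q := hasFDerivAt_snd.comp q hasFDerivAt_snd
      have h1 := differentiableAt_of_contDiffOn hso hφ.contDiffOn_compU hq
      have h2 := differentiableAt_of_contDiffOn hso hU1b hq
      have h3 : fderiv ℝ (fun q => U1 (base q)) q (0, 0, 1) = 0 := by
        rw [fderiv_comp_base (differentiableAt_of_contDiffOn hD hU1s ⟨q, hq, rfl⟩)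
          (Eventually.of_forall fun _ => rfl)]
        ring
      rw [fderiv_fun_sub h1 (h2.fun_mul hu'.differentiableAt),
        fderiv_fun_mul h2 hu'.differentiableAt, hu'.fderiv]
      simp [h3, hU1e q hq]
  have hTd : ∀ q ∈ φ.source, fderiv ℝ (compT φ) q (1, 0, 0) = deriv T q.1 := by
    intro q hq
    rw [fderiv_comp_fst (G := T) (differentiableAt_of_contDiffOn (isOpen_fst_image hso) hTs
      ⟨q, hq, rfl⟩) (eventually_of_mem (hso.mem_nhds hq) hTe)]
    simp
  have hXd : ∀ q ∈ φ.source, fderiv ℝ (compX φ) q (0, 1, 0) = dx X (base q) := by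
    intro q hq
    rw [fderiv_comp_base (G := X) (differentiableAt_of_contDiffOn hD hXs
      ⟨q, hq, rfl⟩) (eventually_of_mem (hso.mem_nhds hq) hXe)]
    simp
  have hcomp : ∀ q ∈ φ.source, φ q = (T q.1, X (base q), U1 (base q) * q.2.2 + U0 (base q)) := by
    intro q hq
    rw [← hTe q hq, ← hXe q hq, ← hU0e q hq, add_sub_cancel]; rfl
  refine ⟨T, X, U1, U0, ⟨hTs, hXs, hU1s, hU0s, hcomp, ?_, ?_, ?_⟩, ?_⟩
  · rintro _ ⟨q, hq, rfl⟩
    rw [show (base q).1 = q.1 from rfl, ← hTd q hq]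
    exact hφ.compT_dt_ne_zero hq (hT q hq)
  · rintro _ ⟨q, hq, rfl⟩
    rw [← hXd q hq]; exact (hX q hq).2.1
  · rintro _ ⟨q, hq, rfl⟩
    rw [← hU1e q hq]
    intro h0
    obtain ⟨⟨w1, w2, w3⟩, h1, h2, h3⟩ := hφ.exists_fderiv_eq hq 0 0 1
    have ht0 := hφ.compT_dt_ne_zero hq (hT q hq)
    rw [fderiv_triple, (hT q hq).1, (hT q hq).2] at h1
    have e1 : w1 = 0 := by simpa [ht0] using h1
    subst e1
    rw [fderiv_triple, (hX q hq).1] at h2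
    have e2 : w2 = 0 := by simpa [(hX q hq).2.1] using h2
    subst e2
    rw [fderiv_triple, h0] at h3
    simp at h3
  · rintro _ ⟨q, hq, rfl⟩
    rw [show (base q).1 = q.1 from rfl, ← hTd q hq, ← hXd q hq, (hX q hq).2.2, hcomp q hq]
    rfl

variable {T : ℝ → ℝ} {X U1 U0 : ℝ × ℝ → ℝ}

/-- It is enough to test source jets with `u_xx = 0` and `u_t = -C u a`, which leaves `u` and `a`
free. The relation `hA` between the diffusion coefficients eliminates `g_x̃x̃` through the
second-order chain rule. -/
theorem IsFiberAffine.determining_identity (hφ : IsPointTransformation φ) (hc : Connects φ θ θ')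
    (hF : IsFiberAffine φ T X U1 U0)
    (hA : ∀ p ∈ base '' φ.source, θ.A2 p * dx X p ^ 2 = θ'.A2 (T p.1, X p) * deriv T p.1)
    {p : ℝ × ℝ} {u : ℝ} (hq : (p.1, p.2, u) ∈ φ.source) (a : ℝ) :
    dx X p * (dt U1 p * u - θ.C p * u * a * U1 p + dt U0 p) -
        dt X p * (dx U1 p * u + U1 p * a + dx U0 p) +
        deriv T p.1 * θ'.C (T p.1, X p) * (U1 p * u + U0 p) *
          (dx U1 p * u + U1 p * a + dx U0 p) =
      θ.A2 p * (dx X p * (dx (dx U1) p * u + 2 * dx U1 p * a + dx (dx U0) p) -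
        dx (dx X) p * (dx U1 p * u + U1 p * a + dx U0 p)) := by
  have hso := φ.open_source
  have hD := isOpen_base_image hso
  have hp : p ∈ base '' φ.source := ⟨_, hq, rfl⟩
  have hp1 := fst_mem_of_mem_base hp
  have eT : ∀ v, fderiv ℝ (compT φ) (p.1, p.2, u) v = deriv T p.1 * v.1 := fun v =>
    fderiv_comp_fst (E := ℝ × ℝ) (F := compT φ) (q := (p.1, p.2, u)) (G := T)
      (differentiableAt_of_contDiffOn (isOpen_fst_image hso) hF.smooth_T hp1) (eventually_of_mem (hso.mem_nhds hq) fun q hq => congrArg Prod.fst (hF.components q hq)) v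
  have eX : ∀ a b c, fderiv ℝ (compX φ) (p.1, p.2, u) (a, b, c) = a * dt X p + b * dx X p :=
    fun a b c =>
    fderiv_comp_base (F := compX φ) (q := (p.1, p.2, u)) (G := X)
      (differentiableAt_of_contDiffOn hD hF.smooth_X hp)
      (eventually_of_mem (hso.mem_nhds hq) fun q hq =>
        congrArg (fun r => r.2.1) (hF.components q hq)) a b c
  obtain ⟨g, hg⟩ := exists_mapsFunctionAt (r := 0) (c := 0) (b := -θ.C p * u * a) (a := a) hφ hq
    (by
      rw [eT, eT, eX, eX]
      have := mul_ne_zero (hF.deriv_ne_zero p hp) (hF.dx_ne_zero p hp)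
      simpa using this)
  set f := quadratic p u (-θ.C p * u * a) a 0 0 with hf
  have hres := (hc _ g p hg).1 (by rw [burgersResidual_quadratic]; ring)
  have hlp : lift f p = (p.1, p.2, u) := lift_quadratic
  have hbase : base (φ (lift f p)) = (T p.1, X p) := by
    rw [hlp, hF.components _ hq]; rfl
  have hsU1 := hF.smooth_U1.contDiffAt (hD.mem_nhds hp)
  have hsU0 := hF.smooth_U0.contDiffAt (hD.mem_nhds hp)
  have hsf : ContDiffAt ℝ ∞ f p := contDiff_quadratic.contDiffAt
  have hgraph : ∀ᶠ y in 𝓝 p, U1 y * f y + U0 y = g (T y.1, X y) := by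
    have hl : ContinuousAt (lift f) p :=
      continuousAt_fst.prodMk (continuousAt_snd.prodMk hsf.continuousAt)
    filter_upwards [hg.graph, hl.eventually (hso.mem_nhds (hlp ▸ hq))] with y hy hy'
    rw [hF.components _ hy'] at hy
    exact hy
  have hg2 : ContDiffAt ℝ 2 g (T p.1, X p) := by
    have := hg.smooth_g
    rw [hbase] at this
    exact_mod_cast contDiffAt_infty.1 this 2
  have hh : ContDiffAt ℝ ∞ (fun y => U1 y * f y + U0 y) p := (hsU1.mul hsf).add hsU0
  obtain ⟨c1, c2, c3⟩ := chain_rule (hF.smooth_T.contDiffAt ((isOpen_fst_image hso).mem_nhds hp1))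
    (contDiffAt_two_of_contDiffOn hD hF.smooth_X hp) hg2
    (by exact_mod_cast contDiffAt_infty.1 hh 2) hgraph
  have dU1 := hsU1.differentiableAt (by simp)
  have dU0 := hsU0.differentiableAt (by simp)
  have df := hsf.differentiableAt (by simp)
  have e1 : dt (fun y => U1 y * f y + U0 y) p = dt U1 p * u + U1 p * (-θ.C p * u * a) + dt U0 p := by
    rw [dt_add (dU1.fun_mul df) dU0, dt_mul dU1 df, hf, dt_quadratic, quadratic_self]
  have e2 : ∀ y ∈ base '' φ.source, dx (fun y => U1 y * f y + U0 y) y =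
      dx U1 y * f y + U1 y * dx f y + dx U0 y := by
    intro y hy
    have dU1 := differentiableAt_of_contDiffOn hD hF.smooth_U1 hy
    have df : DifferentiableAt ℝ f y := contDiff_quadratic.contDiffAt.differentiableAt (n := ∞) (by simp)
    rw [dx_add (dU1.fun_mul df) (differentiableAt_of_contDiffOn hD hF.smooth_U0 hy), dx_mul dU1 df]
  have e3 : dx (dx (fun y => U1 y * f y + U0 y)) p =
      dx (dx U1) p * u + 2 * dx U1 p * a + dx (dx U0) p := by
    have ddU1 := (contDiffAt_dx hsU1).differentiableAt (by simp)
    have ddU0 := (contDiffAt_dx hsU0).differentiableAt (by simp)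
    have ddf := (contDiffAt_dx hsf).differentiableAt (by simp)
    rw [dx_congr_of_eqOn hD e2 hp, dx_add ((ddU1.fun_mul df).fun_add (dU1.fun_mul ddf)) ddU0,
      dx_add (ddU1.fun_mul df) (dU1.fun_mul ddf), dx_mul ddU1 df, dx_mul dU1 ddf, hf,
      dx_dx_quadratic, dx_quadratic, quadratic_self]
    ring
  rw [e1] at c1
  rw [e2 p hp, hf, quadratic_self, dx_quadratic] at c2
  rw [e3] at c3
  have hgv : g (T p.1, X p) = U1 p * u + U0 p := by
    rw [← hgraph.self_of_nhds, hf, quadratic_self]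
  rw [hbase, burgersResidual, hgv] at hres
  apply mul_left_cancel₀ (hF.dx_ne_zero p hp)
  rw [← c2] at *
  linear_combination deriv T p.1 * dx X p ^ 2 * hres - dx X p ^ 2 * c1 +
    θ.A2 p * dx X p ^ 2 * c3 - dx X p ^ 2 * dx (dx g) (T p.1, X p) * hA p hp

end Determining

/-! ### The overdetermined system for `U¹`, `U⁰` and the role of regularity. -/

section Splitting

variable {D : Set (ℝ × ℝ)} {θ : Coeffs} {p : ℝ × ℝ}

theorem InL.C_ne_zero (h : InL D θ) (hp : p ∈ D) : θ.C p ≠ 0 := right_ne_zero_of_mul (h.ne_zero p hp)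

theorem InL.A2_ne_zero (h : InL D θ) (hp : p ∈ D) : θ.A2 p ≠ 0 := left_ne_zero_of_mul (h.ne_zero p hp)

theorem InL.contDiffOn_inner (hD : IsOpen D) (h : InL D θ) :
    ContDiffOn ℝ ∞ (fun q => θ.A2 q * (dx θ.C q / θ.C q ^ 2)) D :=
  h.smooth_A2.mul ((contDiffOn_dx hD h.smooth_C).div (h.smooth_C.pow 2)
    fun _ hp => pow_ne_zero 2 (h.C_ne_zero hp))

theorem InL.contDiffOn_splitting (hD : IsOpen D) (h : InL D θ) :
    ContDiffOn ℝ ∞ (splitting θ) D :=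
  ((contDiffOn_dt hD h.smooth_C).div h.smooth_C fun _ hp => h.C_ne_zero hp).sub
    (h.smooth_C.mul (contDiffOn_dx hD (h.contDiffOn_inner hD)))

/-- Restricted to a segment from `p`, `W` solves a linear homogeneous ordinary differential equation
with bounded coefficient and zero initial value, so a Grönwall estimate forces it to vanish. -/
theorem eventually_eq_zero_of_linear {W S : ℝ × ℝ → ℝ} (hD : IsOpen D)
    (hW : ContDiffOn ℝ ∞ W D) (hS : ContinuousOn S D) (hx : ∀ p ∈ D, dx W p = 0)
    (ht : ∀ p ∈ D, dt W p = S p * W p) (hp : p ∈ D) (h0 : W p = 0) : ∀ᶠ q in 𝓝 p, W q = 0 := by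
  obtain ⟨K, hK⟩ : ∃ K, ∀ᶠ q in 𝓝 p, ‖S q‖ < K :=
    ⟨‖S p‖ + 1, (hS.continuousAt (hD.mem_nhds hp)).norm.eventually_lt continuousAt_const (by simp)⟩
  obtain ⟨ε, hε, hb⟩ := Metric.eventually_nhds_iff_ball.1 (hK.and (hD.mem_nhds hp))
  filter_upwards [Metric.ball_mem_nhds p hε] with q hq
  have hseg : ∀ s ∈ Icc (0 : ℝ) 1, p + s • (q - p) ∈ Metric.ball p ε := fun s hs =>
    (convex_ball p ε).add_smul_sub_mem (Metric.mem_ball_self hε) hq hs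
  have hd : ∀ s ∈ Icc (0 : ℝ) 1, HasDerivAt (fun s : ℝ => W (p + s • (q - p)))
      ((q - p).1 * (S (p + s • (q - p)) * W (p + s • (q - p)))) s := by
    intro s hs
    have hm := (hb _ (hseg s hs)).2
    have hl : HasDerivAt (fun s : ℝ => p + s • (q - p)) (q - p) s := by
      simpa using ((hasDerivAt_id s).smul_const (q - p)).const_add p
    have := (differentiableAt_of_contDiffOn hD hW hm).hasFDerivAt.comp_hasDerivAt s hl
    refine this.congr_deriv ?_
    rw [show q - p = ((q - p).1, (q - p).2) from rfl, fderiv_pair, hx _ hm, ht _ hm]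
    ring
  have := eq_zero_of_abs_deriv_le_mul_abs_self_of_eq_zero_right
    (f := fun s : ℝ => W (p + s • (q - p))) (K := ‖(q - p).1‖ * K) (a := 0) (b := 1)
    (fun s hs => (hd s hs).continuousAt.continuousWithinAt)
    (fun s hs => (hd s (Ico_subset_Icc_self hs)).hasDerivWithinAt) (by simpa using h0)
    (fun s hs => by
      rw [norm_mul, norm_mul, ← mul_assoc]
      gcongr
      exact (hb _ (hseg s (Ico_subset_Icc_self hs))).1.le) 1 (by simp)
  simpa using this

/-- The set of points near which `W` vanishes is open, and relatively closed in `D` by continuity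
and local uniqueness. -/
theorem eq_zero_of_linear {W S : ℝ × ℝ → ℝ} (hD : IsOpen D) (hc : IsPreconnected D)
    (hW : ContDiffOn ℝ ∞ W D) (hS : ContinuousOn S D) (hx : ∀ p ∈ D, dx W p = 0)
    (ht : ∀ p ∈ D, dt W p = S p * W p) (hp : p ∈ D) (h0 : W p = 0) : ∀ q ∈ D, W q = 0 := by
  have hloc := fun {q} hq h => eventually_eq_zero_of_linear (p := q) hD hW hS hx ht hq h
  have hsub : D ⊆ {q | ∀ᶠ y in 𝓝 q, W y = 0} := by
    refine hc.subset_of_closure_inter_subset isOpen_setOfPred_eventually_nhds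
      ⟨p, hp, hloc hp h0⟩ ?_
    rintro q ⟨hq, hqD⟩
    refine hloc hqD ?_
    by_contra hne
    have := (hW.continuousOn.continuousAt (hD.mem_nhds hqD)).eventually_ne hne
    obtain ⟨y, hy1, hy2⟩ := mem_closure_iff_nhds.1 hq _ this
    have hy : ∀ᶠ z in 𝓝 y, W z = 0 := hy2
    exact hy1 hy.self_of_nhds
  exact fun q hq => (hsub hq).self_of_nhds

theorem exists_eq_const {F : ℝ × ℝ → ℝ} (hD : IsOpen D) (hc : IsPreconnected D)
    (hF : ContDiffOn ℝ ∞ F D) (ht : ∀ p ∈ D, dt F p = 0) (hx : ∀ p ∈ D, dx F p = 0) :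
    ∃ k, ∀ p ∈ D, F p = k := by
  obtain ⟨k, hk⟩ := hD.exists_is_const_of_fderiv_eq_zero hc (hF.differentiableOn (by simp))
    (fun p hp => by
      ext <;> simp [show fderiv ℝ F p (1, 0) = 0 from ht p hp,
        show fderiv ℝ F p (0, 1) = 0 from hx p hp])
  exact ⟨k, hk⟩

/-- For coefficients of the regular subclass, the system for the factor and the shift of the
transformation of `u` has constant solutions only. -/
theorem InL1.dt_eq_zero {U1 U0 : ℝ × ℝ → ℝ} (hD : IsOpen D) (hc : IsPreconnected D)
    (hθ : InL1 D θ) (hU1 : ContDiffOn ℝ ∞ U1 D) (hU0 : ContDiffOn ℝ ∞ U0 D)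
    (h1 : ∀ p ∈ D, dx U1 p = 0) (h2 : ∀ p ∈ D, dt U1 p + θ.C p * dx U0 p = 0)
    (h3 : ∀ p ∈ D, dt U0 p = θ.A2 p * dx (dx U0) p) : ∀ p ∈ D, dt U1 p = 0 := by
  obtain ⟨hL, p₀, hp₀, hS₀⟩ := hθ
  set W := dt U1 with hWdef
  have hW : ContDiffOn ℝ ∞ W D := contDiffOn_dt hD hU1
  have hWx : ∀ p ∈ D, dx W p = 0 := by
    intro p hp
    rw [hWdef, ← dt_dx_comm (contDiffAt_two_of_contDiffOn hD hU1 hp),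
      dt_congr_of_eqOn hD h1 hp, dt_const]
  set m : ℝ × ℝ → ℝ := fun q => θ.A2 q * (dx θ.C q / θ.C q ^ 2) with hm
  have hms : ContDiffOn ℝ ∞ m D := hL.contDiffOn_inner hD
  have dW := fun {p} hp => differentiableAt_of_contDiffOn (q := p) hD hW hp
  have dm := fun {p} hp => differentiableAt_of_contDiffOn (q := p) hD hms hp
  have dC := fun {p} hp => differentiableAt_of_contDiffOn (q := p) hD hL.smooth_C hp
  have hU0x : ∀ p ∈ D, dx U0 p = (fun q => (-1) * (W q / θ.C q)) p := by
    intro p hp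
    have := hL.C_ne_zero hp
    have := h2 p hp
    field_simp
    linear_combination this
  have hU0t : ∀ p ∈ D, dt U0 p = (fun q => W q * m q) p := by
    intro p hp
    have hC := hL.C_ne_zero hp
    rw [h3 p hp, dx_congr_of_eqOn hD hU0x hp, dx_mul (differentiableAt_const _)
      (differentiableAt_div (dW hp) (dC hp) hC), dx_const, dx_div (dW hp) (dC hp) hC, hWx p hp, hm]
    field_simp
    ring
  -- The compatibility condition `(U⁰_x)_t = (U⁰_t)_x` with `U⁰_x = -W / C` and `U⁰_t = W m`; here
  -- `splitting` arises.
  have hWt : ∀ p ∈ D, dt W p = splitting θ p * W p := by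
    intro p hp
    have hC := hL.C_ne_zero hp
    have := dt_dx_comm (contDiffAt_two_of_contDiffOn hD hU0 hp)
    rw [dt_congr_of_eqOn hD hU0x hp, dx_congr_of_eqOn hD hU0t hp, dx_mul (dW hp) (dm hp), hWx p hp,
      dt_mul (differentiableAt_const _) (differentiableAt_div (dW hp) (dC hp) hC), dt_const,
      dt_div (dW hp) (dC hp) hC] at this
    change dt W p = (dt θ.C p / θ.C p - θ.C p * dx m p) * W p
    field_simp at this ⊢
    linear_combination -this
  have hSs := hL.contDiffOn_splitting hD
  -- Differentiating `W_t = S W` in `x` and using `W_x = 0` leaves `S_x W = 0`.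
  have hW0 : W p₀ = 0 := by
    have := dt_dx_comm (contDiffAt_two_of_contDiffOn hD hW hp₀)
    rw [dt_congr_of_eqOn hD (g := fun _ => 0) hWx hp₀, dt_const,
      dx_congr_of_eqOn hD (g := fun q => splitting θ q * W q) hWt hp₀,
      dx_mul (differentiableAt_of_contDiffOn hD hSs hp₀) (dW hp₀), hWx p₀ hp₀] at this
    have : dx (splitting θ) p₀ * W p₀ = 0 := by linear_combination -this
    exact (mul_eq_zero.1 this).resolve_left hS₀
  exact eq_zero_of_linear hD hc hW hSs.continuousOn hWx hWt hp₀ hW0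

end Splitting

/-! ### Splitting the determining identity and concluding necessity. -/

section Form

variable {φ : OpenPartialHomeomorph (ℝ × ℝ × ℝ) (ℝ × ℝ × ℝ)} {θ θ' : Coeffs}
  {T : ℝ → ℝ} {X U1 U0 : ℝ × ℝ → ℝ}

/-- The identity is affine in the slope `a` and at most quadratic in `u`, and `u` ranges over an
open set, so the coefficients vanish separately. The part linear in `a` (`lin`) gives the rule for
`C` and, once `U¹_x = 0` is known, the Kolmogorov equation; the part free of `a` (`quad`) gives
`U¹_x = 0` from its `u²` coefficient and the equations for `U¹_t`, `U⁰_t` from the other two. -/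
theorem IsFiberAffine.determining_equations (hφ : IsPointTransformation φ) (hc : Connects φ θ θ')
    (hF : IsFiberAffine φ T X U1 U0) (hθ : InL (base '' φ.source) θ)
    (hA : ∀ p ∈ base '' φ.source, θ.A2 p * dx X p ^ 2 = θ'.A2 (T p.1, X p) * deriv T p.1) :
    ∀ p ∈ base '' φ.source, dx U1 p = 0 ∧
      deriv T p.1 * θ'.C (T p.1, X p) * U1 p = θ.C p * dx X p ∧
      dt X p = θ.A2 p * dx (dx X) p + U0 p * θ.C p / U1 p * dx X p ∧
      dt U1 p + θ.C p * dx U0 p = 0 ∧ dt U0 p = θ.A2 p * dx (dx U0) p := by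
  have hso := φ.open_source
  have hD := isOpen_base_image hso
  have step : ∀ p ∈ base '' φ.source, ∃ u, ∀ᶠ v in 𝓝 u, (p.1, p.2, v) ∈ φ.source := by
    intro p hp
    obtain ⟨u, hu⟩ := exists_lift_mem hp
    exact ⟨u, (by fun_prop : Continuous fun v : ℝ => (p.1, p.2, v)).continuousAt.eventually
      (hso.mem_nhds hu)⟩
  have lin : ∀ p ∈ base '' φ.source,
      deriv T p.1 * θ'.C (T p.1, X p) * U1 p = θ.C p * dx X p ∧
      -dt X p * U1 p + deriv T p.1 * θ'.C (T p.1, X p) * U0 p * U1 p =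
        θ.A2 p * (2 * dx X p * dx U1 p - dx (dx X) p * U1 p) := by
    intro p hp
    obtain ⟨u, hu⟩ := step p hp
    have key := coeff_eq_zero_of_eventually (u := u) (α := 0)
      (β := -dx X p * θ.C p * U1 p + deriv T p.1 * θ'.C (T p.1, X p) * U1 p * U1 p)
      (γ := -dt X p * U1 p + deriv T p.1 * θ'.C (T p.1, X p) * U0 p * U1 p -
        θ.A2 p * (2 * dx X p * dx U1 p - dx (dx X) p * U1 p))
      (by
        filter_upwards [hu] with v hv
        have h0 := hF.determining_identity hφ hc hA hv 0
        have h1 := hF.determining_identity hφ hc hA hv 1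
        linear_combination h1 - h0)
    refine ⟨?_, by linear_combination key.2.2⟩
    apply mul_left_cancel₀ (hF.ne_zero p hp)
    linear_combination key.2.1
  have quad : ∀ p ∈ base '' φ.source,
      deriv T p.1 * θ'.C (T p.1, X p) * U1 p * dx U1 p = 0 ∧
      dx X p * dt U1 p - dt X p * dx U1 p + deriv T p.1 * θ'.C (T p.1, X p) *
        (U1 p * dx U0 p + U0 p * dx U1 p) -
        θ.A2 p * (dx X p * dx (dx U1) p - dx (dx X) p * dx U1 p) = 0 ∧
      dx X p * dt U0 p - dt X p * dx U0 p + deriv T p.1 * θ'.C (T p.1, X p) * U0 p * dx U0 p -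
        θ.A2 p * (dx X p * dx (dx U0) p - dx (dx X) p * dx U0 p) = 0 := by
    intro p hp
    obtain ⟨u, hu⟩ := step p hp
    refine coeff_eq_zero_of_eventually (u := u) ?_
    filter_upwards [hu] with v hv
    have h0 := hF.determining_identity hφ hc hA hv 0
    linear_combination h0
  have hU1x : ∀ p ∈ base '' φ.source, dx U1 p = 0 := by
    intro p hp
    have h := (quad p hp).1
    rw [(lin p hp).1] at h
    exact (mul_eq_zero.1 h).resolve_left (mul_ne_zero (hθ.C_ne_zero hp) (hF.dx_ne_zero p hp))
  intro p hp
  have hx := hU1x p hp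
  have hxx : dx (dx U1) p = 0 := by rw [dx_congr_of_eqOn hD (g := fun _ => 0) hU1x hp, dx_const]
  have hX0 := hF.dx_ne_zero p hp
  have hU0 := hF.ne_zero p hp
  obtain ⟨l1, l2⟩ := lin p hp
  obtain ⟨-, q2, q3⟩ := quad p hp
  have kolm : dt X p = θ.A2 p * dx (dx X) p + U0 p * θ.C p / U1 p * dx X p := by
    field_simp
    rw [hx] at l2
    linear_combination -l2 + U0 p * l1
  rw [hx, hxx] at q2
  refine ⟨hx, l1, kolm, ?_, ?_⟩
  · apply mul_left_cancel₀ hX0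
    linear_combination q2 - dx U0 p * l1
  · apply mul_left_cancel₀ hX0
    apply mul_left_cancel₀ hU0
    rw [hx] at l2
    linear_combination U1 p * q3 - dx U0 p * l2

theorem Connects.hasForm (hφ : IsPointTransformation φ) (hΩ : HasConnectedSlices φ.source)
    (hθ : InL1 (base '' φ.source) θ) (hθ' : InL (base '' φ.target) θ') (hc : Connects φ θ θ') :
    ∃ (T : ℝ → ℝ) (X : ℝ × ℝ → ℝ) (U1 U0 : ℝ), HasForm φ θ T X U1 U0 ∧
      ∀ p ∈ base '' φ.source,
        θ'.C (T p.1, X p) = dx X p / (deriv T p.1 * U1) * θ.C p ∧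
        θ'.A2 (T p.1, X p) = dx X p ^ 2 / deriv T p.1 * θ.A2 p := by
  have hD := isOpen_base_image φ.open_source
  have hconn : IsPreconnected (base '' φ.source) :=
    hΩ.connected.isPreconnected.image _ continuous_base.continuousOn
  obtain ⟨T, X, U1, U0, hF, hA⟩ := hc.isFiberAffine hφ hΩ (fun y hy => hθ.1.A2_ne_zero hy)
    (fun y hy => hθ'.A2_ne_zero hy)
  have hdet := hF.determining_equations hφ hc hθ.1 hA
  have hU1t := hθ.dt_eq_zero hD hconn hF.smooth_U1 hF.smooth_U0 (fun p hp => (hdet p hp).1)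
    (fun p hp => (hdet p hp).2.2.2.1) (fun p hp => (hdet p hp).2.2.2.2)
  have hU0x : ∀ p ∈ base '' φ.source, dx U0 p = 0 := by
    intro p hp
    have := (hdet p hp).2.2.2.1
    rw [hU1t p hp, zero_add] at this
    exact (mul_eq_zero.1 this).resolve_left (hθ.1.C_ne_zero hp)
  have hU0t : ∀ p ∈ base '' φ.source, dt U0 p = 0 := by
    intro p hp
    rw [(hdet p hp).2.2.2.2, dx_congr_of_eqOn hD (g := fun _ => 0) hU0x hp, dx_const, mul_zero]
  obtain ⟨k1, hk1⟩ := exists_eq_const hD hconn hF.smooth_U1 hU1t fun p hp => (hdet p hp).1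
  obtain ⟨k0, hk0⟩ := exists_eq_const hD hconn hF.smooth_U0 hU0t hU0x
  refine ⟨T, X, k1, k0, ⟨hF.smooth_T, hF.smooth_X, ?_, ?_, ?_⟩, ?_⟩
  · intro t x u hq
    have hp : base (t, x, u) ∈ base '' φ.source := ⟨_, hq, rfl⟩
    rw [hF.components _ hq, hk1 _ hp, hk0 _ hp]; rfl
  · intro p hp
    exact mul_ne_zero (mul_ne_zero (hF.deriv_ne_zero p hp) (hF.dx_ne_zero p hp))
      (hk1 p hp ▸ hF.ne_zero p hp)
  · intro p hp
    rw [(hdet p hp).2.2.1, hk1 p hp, hk0 p hp]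
  · intro p hp
    have h1 := hF.deriv_ne_zero p hp
    have h2 := hk1 p hp ▸ hF.ne_zero p hp
    have h3 := hA p hp
    have h4 := hk1 p hp ▸ (hdet p hp).2.1
    constructor
    · field_simp; linear_combination h4
    · field_simp; linear_combination -h3

end Form

/-! ### Transformations of the stated form connect the equations and preserve regularity. -/

section Sufficiency

variable {φ : OpenPartialHomeomorph (ℝ × ℝ × ℝ) (ℝ × ℝ × ℝ)} {θ θ' : Coeffs}
  {T : ℝ → ℝ} {X : ℝ × ℝ → ℝ} {U1 U0 : ℝ} {p : ℝ × ℝ}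

theorem HasForm.deriv_ne_zero (hF : HasForm φ θ T X U1 U0) (hp : p ∈ base '' φ.source) :
    deriv T p.1 ≠ 0 := left_ne_zero_of_mul (left_ne_zero_of_mul (hF.nondegenerate p hp))

theorem HasForm.dx_ne_zero (hF : HasForm φ θ T X U1 U0) (hp : p ∈ base '' φ.source) :
    dx X p ≠ 0 := right_ne_zero_of_mul (left_ne_zero_of_mul (hF.nondegenerate p hp))

theorem HasForm.ne_zero (hF : HasForm φ θ T X U1 U0) (hp : p ∈ base '' φ.source) :
    U1 ≠ 0 := right_ne_zero_of_mul (hF.nondegenerate p hp)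

theorem HasForm.apply_eq (hF : HasForm φ θ T X U1 U0) {q : ℝ × ℝ × ℝ} (hq : q ∈ φ.source) :
    φ q = (T q.1, X (base q), U1 * q.2.2 + U0) := hF.components q.1 q.2.1 q.2.2 hq

theorem HasForm.mem_base_target_iff (hF : HasForm φ θ T X U1 U0) {y : ℝ × ℝ} :
    y ∈ base '' φ.target ↔ ∃ p ∈ base '' φ.source, (T p.1, X p) = y := by
  constructor
  · rintro ⟨r, hr, rfl⟩
    have h := hF.apply_eq (φ.map_target hr)
    rw [φ.right_inv hr] at h
    exact ⟨_, ⟨_, φ.map_target hr, rfl⟩, (congrArg base h).symm⟩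
  · rintro ⟨_, ⟨q, hq, rfl⟩, rfl⟩
    exact ⟨φ q, φ.map_source hq, by rw [hF.apply_eq hq]; rfl⟩

theorem HasForm.contDiffAt_T (hF : HasForm φ θ T X U1 U0) (hp : p ∈ base '' φ.source) :
    ContDiffAt ℝ ∞ T p.1 :=
  hF.smooth_T.contDiffAt ((isOpen_fst_image φ.open_source).mem_nhds (fst_mem_of_mem_base hp))

theorem HasForm.connects (hF : HasForm φ θ T X U1 U0)
    (h : ∀ p ∈ base '' φ.source,
      θ'.C (T p.1, X p) = dx X p / (deriv T p.1 * U1) * θ.C p ∧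
      θ'.A2 (T p.1, X p) = dx X p ^ 2 / deriv T p.1 * θ.A2 p) : Connects φ θ θ' := by
  intro f g p hg
  have hso := φ.open_source
  have hD := isOpen_base_image hso
  have hp : p ∈ base '' φ.source := ⟨_, hg.mem_source, rfl⟩
  have hbase : base (φ (lift f p)) = (T p.1, X p) := by rw [hF.apply_eq hg.mem_source]; rfl
  have hsf := hg.smooth_f
  have hgraph : ∀ᶠ y in 𝓝 p, U1 * f y + U0 = g (T y.1, X y) := by
    have hl : ContinuousAt (lift f) p :=
      continuousAt_fst.prodMk (continuousAt_snd.prodMk hsf.continuousAt)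
    filter_upwards [hg.graph, hl.eventually (hso.mem_nhds hg.mem_source)] with y hy hy'
    rw [hF.apply_eq hy'] at hy
    exact hy
  have hg2 : ContDiffAt ℝ 2 g (T p.1, X p) := by
    have := hg.smooth_g
    rw [hbase] at this
    exact_mod_cast contDiffAt_infty.1 this 2
  have hh : ContDiffAt ℝ ∞ (fun y => U1 * f y + U0) p :=
    (contDiffAt_const.mul hsf).add contDiffAt_const
  obtain ⟨c1, c2, c3⟩ := chain_rule (hF.contDiffAt_T hp)
    (contDiffAt_two_of_contDiffOn hD hF.smooth_X hp) hg2
    (by exact_mod_cast contDiffAt_infty.1 hh 2) hgraph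
  have e1 : dt (fun y => U1 * f y + U0) p = U1 * dt f p := by
    have df := hsf.differentiableAt (by simp)
    rw [dt_add ((differentiableAt_const U1).fun_mul df) (differentiableAt_const U0),
      dt_mul (differentiableAt_const U1) df, dt_const, dt_const]
    ring
  have hev : ∀ᶠ y in 𝓝 p, DifferentiableAt ℝ f y :=
    ((hsf.of_le (by simp) : ContDiffAt ℝ 1 f p).eventually (by simp)).mono
      fun y hy => hy.differentiableAt (by simp)
  have e2 : dx (fun y => U1 * f y + U0) =ᶠ[𝓝 p] fun y => U1 * dx f y := by
    filter_upwards [hev] with y df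
    rw [dx_add ((differentiableAt_const U1).fun_mul df) (differentiableAt_const U0),
      dx_mul (differentiableAt_const U1) df, dx_const, dx_const]
    ring
  have e3 : dx (dx (fun y => U1 * f y + U0)) p = U1 * dx (dx f) p := by
    rw [dx_congr e2, dx_mul (differentiableAt_const U1)
      ((contDiffAt_dx hsf).differentiableAt (by simp)), dx_const]
    ring
  rw [e1] at c1
  rw [e2.self_of_nhds] at c2
  rw [e3] at c3
  have hgv : g (T p.1, X p) = U1 * f p + U0 := hgraph.self_of_nhds.symm
  have hT0 := hF.deriv_ne_zero hp
  have hX0 := hF.dx_ne_zero hp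
  have hU0 := hF.ne_zero hp
  have hk := hF.kolmogorov p hp
  obtain ⟨hC, hA⟩ := h p hp
  -- The two residuals are proportional with nonzero factors; the Kolmogorov equation cancels the
  -- terms `X_t g_x̃`, `A² X_xx g_x̃` and the one coming from the shift `U0`.
  have key : deriv T p.1 * burgersResidual θ' g (base (φ (lift f p))) =
      U1 * burgersResidual θ f p := by
    rw [hbase, burgersResidual, burgersResidual, hgv, hC, hA]
    have hC' : deriv T p.1 * (dx X p / (deriv T p.1 * U1) * θ.C p) = dx X p * θ.C p / U1 := by
      field_simp
    have hA' : deriv T p.1 * (dx X p ^ 2 / deriv T p.1 * θ.A2 p) = dx X p ^ 2 * θ.A2 p := by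
      field_simp
    have hC2 : dx X p * θ.C p / U1 * U1 = dx X p * θ.C p := by field_simp
    have hk' : dt X p = θ.A2 p * dx (dx X) p + U0 * (dx X p * θ.C p / U1) := by
      rw [hk]; ring
    linear_combination c1 - dx g (T p.1, X p) * hk' - θ.A2 p * c3 + θ.C p * f p * c2 +
      (U1 * f p + U0) * dx g (T p.1, X p) * hC' - dx (dx g) (T p.1, X p) * hA' +
      f p * dx g (T p.1, X p) * hC2
  constructor
  · intro h0
    rw [h0, mul_zero] at key
    exact (mul_eq_zero.1 key).resolve_left hT0
  · intro h0
    rw [h0, mul_zero] at key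
    exact (mul_eq_zero.1 key.symm).resolve_left hU0

/-- Functions on the domain of the independent variables are transferred smoothly. -/
theorem HasForm.contDiffOn_of_comp (hφ : IsPointTransformation φ) (hF : HasForm φ θ T X U1 U0)
    {F F' : ℝ × ℝ → ℝ} (hFs : ContDiffOn ℝ ∞ F (base '' φ.source))
    (h : ∀ p ∈ base '' φ.source, F' (T p.1, X p) = F p) :
    ContDiffOn ℝ ∞ F' (base '' φ.target) := by
  rintro _ ⟨r, hr, rfl⟩
  -- Freezing `ũ` at its value at `r` expresses the inverse of `(T, X)` locally through `φ.symm`,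
  -- which is smooth.
  let j : ℝ × ℝ → ℝ × ℝ × ℝ := fun y => (y.1, y.2, r.2.2)
  have hj : ContDiff ℝ ∞ j := contDiff_fst.prodMk (contDiff_snd.prodMk contDiff_const)
  have hjr : j (base r) = r := rfl
  have hD := isOpen_base_image φ.open_source
  have h1 : ContDiffAt ℝ ∞ (fun y => base (φ.symm (j y))) (base r) := by
    have hs : ContDiffAt ℝ ∞ φ.symm (j (base r)) :=
      hφ.smooth_symm.contDiffAt (φ.open_target.mem_nhds hr)
    have hb : ContDiff ℝ ∞ base := contDiff_fst.prodMk (contDiff_fst.comp contDiff_snd)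
    exact hb.contDiffAt.comp _ (hs.comp _ hj.contDiffAt)
  have h2 : ContDiffAt ℝ ∞ (fun y => F (base (φ.symm (j y)))) (base r) :=
    ContDiffAt.comp (g := F) _ (hFs.contDiffAt (hD.mem_nhds ⟨_, φ.map_target hr, rfl⟩)) h1
  refine (h2.congr_of_eventuallyEq ?_).contDiffWithinAt
  have hm : ∀ᶠ y in 𝓝 (base r), j y ∈ φ.target :=
    hj.continuous.continuousAt.eventually (φ.open_target.mem_nhds hr)
  filter_upwards [hm] with y hy
  rw [← h _ ⟨_, φ.map_target hy, rfl⟩]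
  have := hF.apply_eq (φ.map_target hy)
  rw [φ.right_inv hy] at this
  exact congrArg F' (congrArg base this)

theorem HasForm.chain_rule (hφ : IsPointTransformation φ) (hF : HasForm φ θ T X U1 U0)
    {F F' : ℝ × ℝ → ℝ} (hFs : ContDiffOn ℝ ∞ F (base '' φ.source))
    (h : ∀ p ∈ base '' φ.source, F' (T p.1, X p) = F p) (hp : p ∈ base '' φ.source) :
    deriv T p.1 * dt F' (T p.1, X p) + dt X p * dx F' (T p.1, X p) = dt F p ∧
      dx X p * dx F' (T p.1, X p) = dx F p := by
  have hD := isOpen_base_image φ.open_source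
  have hD' := isOpen_base_image φ.open_target
  obtain ⟨h1, h2, -⟩ := VarBurgers.chain_rule (hF.contDiffAt_T hp)
    (contDiffAt_two_of_contDiffOn hD hF.smooth_X hp)
    (contDiffAt_two_of_contDiffOn hD' (hF.contDiffOn_of_comp hφ hFs h)
      (hF.mem_base_target_iff.2 ⟨p, hp, rfl⟩)) (contDiffAt_two_of_contDiffOn hD hFs hp)
    (eventually_of_mem (hD.mem_nhds hp) fun y hy => (h y hy).symm)
  exact ⟨h1, h2⟩

theorem HasForm.contDiffOn_deriv (hF : HasForm φ θ T X U1 U0) :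
    ContDiffOn ℝ ∞ (fun q : ℝ × ℝ => deriv T q.1) (base '' φ.source) :=
  (hF.smooth_T.deriv_of_isOpen (m := ∞) (isOpen_fst_image φ.open_source) (by simp)).comp
    contDiff_fst.contDiffOn fun _ hp => fst_mem_of_mem_base hp

theorem HasForm.dx_deriv (hF : HasForm φ θ T X U1 U0) (hp : p ∈ base '' φ.source) :
    dx (fun q : ℝ × ℝ => deriv T q.1) p = 0 := by
  have hd : DifferentiableAt ℝ (deriv T) p.1 := differentiableAt_of_contDiffOn
    (isOpen_fst_image φ.open_source) (hF.smooth_T.deriv_of_isOpen (m := ∞)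
      (isOpen_fst_image φ.open_source) (by simp)) (fst_mem_of_mem_base hp)
  rw [dx, fderiv_comp_fst (E := ℝ) (q := p) hd (Eventually.of_forall fun _ => rfl)]
  simp

theorem HasForm.inL (hφ : IsPointTransformation φ) (hF : HasForm φ θ T X U1 U0)
    (hθ : InL (base '' φ.source) θ)
    (h : ∀ p ∈ base '' φ.source,
      θ'.C (T p.1, X p) = dx X p / (deriv T p.1 * U1) * θ.C p ∧
      θ'.A2 (T p.1, X p) = dx X p ^ 2 / deriv T p.1 * θ.A2 p) :
    InL (base '' φ.target) θ' := by
  have hD := isOpen_base_image φ.open_source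
  have hXx := contDiffOn_dx hD hF.smooth_X
  refine ⟨hF.contDiffOn_of_comp hφ (((hXx.pow 2).div hF.contDiffOn_deriv
      fun p hp => hF.deriv_ne_zero hp).mul hθ.smooth_A2) fun p hp => (h p hp).2,
    hF.contDiffOn_of_comp hφ ((hXx.div (hF.contDiffOn_deriv.mul contDiffOn_const)
      fun p hp => mul_ne_zero (hF.deriv_ne_zero hp) (hF.ne_zero hp)).mul hθ.smooth_C)
      fun p hp => (h p hp).1, ?_⟩
  intro y hy
  obtain ⟨p, hp, rfl⟩ := hF.mem_base_target_iff.1 hy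
  have h1 := hF.deriv_ne_zero hp
  have h2 := hF.dx_ne_zero hp
  have h3 := hF.ne_zero hp
  have h4 := hθ.C_ne_zero hp
  have h5 := hθ.A2_ne_zero hp
  rw [(h p hp).1, (h p hp).2]
  positivity

/-- The transformation of the function `splitting`. -/
theorem HasForm.splitting_eq (hφ : IsPointTransformation φ) (hF : HasForm φ θ T X U1 U0)
    (hθ : InL (base '' φ.source) θ)
    (h : ∀ p ∈ base '' φ.source,
      θ'.C (T p.1, X p) = dx X p / (deriv T p.1 * U1) * θ.C p ∧
      θ'.A2 (T p.1, X p) = dx X p ^ 2 / deriv T p.1 * θ.A2 p) (hp : p ∈ base '' φ.source) :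
    splitting θ' (T p.1, X p) = (splitting θ p -
      dt (fun q : ℝ × ℝ => deriv T q.1) p / deriv T p.1) / deriv T p.1 := by
  have hD := isOpen_base_image φ.open_source
  have hXx := contDiffOn_dx hD hF.smooth_X
  have hXt := contDiffOn_dt hD hF.smooth_X
  set s : ℝ × ℝ → ℝ := fun q => deriv T q.1 with hs
  have hss : ContDiffOn ℝ ∞ s (base '' φ.source) := hF.contDiffOn_deriv
  have hsp : ∀ p, deriv T p.1 = s p := fun p => rfl
  have hs0 : ∀ {p}, p ∈ base '' φ.source → s p ≠ 0 := fun hp => hF.deriv_ne_zero hp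
  have hX0 := fun {p} hp => hF.dx_ne_zero (p := p) hp
  have hU0 := hF.ne_zero hp
  have hC0 := fun {p} hp => hθ.C_ne_zero (p := p) hp
  have dX := fun {p} hp => differentiableAt_of_contDiffOn (q := p) hD hXx hp
  have dXt := fun {p} hp => differentiableAt_of_contDiffOn (q := p) hD hXt hp
  have dC := fun {p} hp => differentiableAt_of_contDiffOn (q := p) hD hθ.smooth_C hp
  have ds := fun {p} hp => differentiableAt_of_contDiffOn (q := p) hD hss hp
  have dm := fun {p} hp => differentiableAt_of_contDiffOn (q := p) hD (hθ.contDiffOn_inner hD) hp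
  set k : ℝ × ℝ → ℝ := fun q => dx X q * θ.C q / (s q * U1) with hk
  have hks : ContDiffOn ℝ ∞ k (base '' φ.source) := (hXx.mul hθ.smooth_C).div
    (hss.mul contDiffOn_const) fun p hp => mul_ne_zero (hs0 hp) hU0
  have hkC : ∀ p ∈ base '' φ.source, θ'.C (T p.1, X p) = k p := by
    intro p hp; rw [(h p hp).1, hk, hsp]; ring
  have kx : ∀ p ∈ base '' φ.source,
      dx k p = (dx (dx X) p * θ.C p + dx X p * dx θ.C p) / (s p * U1) := by
    intro p hp
    have hne := mul_ne_zero (hs0 hp) hU0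
    rw [hk, dx_div ((dX hp).fun_mul (dC hp)) ((ds hp).fun_mul (differentiableAt_const U1)) hne,
      dx_mul (dX hp) (dC hp), dx_mul (ds hp) (differentiableAt_const U1), dx_const,
      show dx s p = 0 from hF.dx_deriv hp]
    have := hs0 hp
    field_simp
    ring
  have kt : dt k p = ((dx (dt X) p * θ.C p + dx X p * dt θ.C p) * s p -
      dx X p * θ.C p * dt s p) / (s p ^ 2 * U1) := by
    have hne := mul_ne_zero (hs0 hp) hU0
    rw [hk, dt_div ((dX hp).fun_mul (dC hp)) ((ds hp).fun_mul (differentiableAt_const U1)) hne,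
      dt_mul (dX hp) (dC hp), dt_mul (ds hp) (differentiableAt_const U1), dt_const,
      dt_dx_comm (contDiffAt_two_of_contDiffOn hD hF.smooth_X hp)]
    have := hs0 hp
    field_simp
    ring
  set m : ℝ × ℝ → ℝ := fun q => θ.A2 q * (dx θ.C q / θ.C q ^ 2) with hm
  set m' : ℝ × ℝ → ℝ := fun q => θ'.A2 q * (dx θ'.C q / θ'.C q ^ 2) with hm'
  -- The pull-back of `Ã² C̃_x̃ / C̃²` is `U1 * (m + A² X_xx / (C X_x))`; the Kolmogorov equation
  -- replaces `A² X_xx`, so that no third derivative of `X` in `x` appears after the next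
  -- differentiation.
  set M : ℝ × ℝ → ℝ := fun q => U1 * (m q + dt X q / (θ.C q * dx X q)) - U0 with hM
  have hMs : ContDiffOn ℝ ∞ M (base '' φ.source) :=
    (contDiffOn_const.mul ((hθ.contDiffOn_inner hD).add (hXt.div (hθ.smooth_C.mul hXx)
      fun p hp => mul_ne_zero (hC0 hp) (hX0 hp)))).sub contDiffOn_const
  have hmM : ∀ p ∈ base '' φ.source, m' (T p.1, X p) = M p := by
    intro p hp
    have c := (hF.chain_rule hφ hks hkC hp).2
    have h1 := hs0 hp
    have h2 := hX0 hp
    have h3 := hC0 hp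
    have c' : dx θ'.C (T p.1, X p) = dx k p / dx X p := by field_simp; linear_combination c
    simp only [hm', hM, hm]
    rw [c', kx p hp, (h p hp).2, hkC p hp, hF.kolmogorov p hp, hsp]
    simp only [hk]
    field_simp
    ring
  have Mx : dx M p = U1 * (dx m p + (dx (dt X) p * (θ.C p * dx X p) -
      dt X p * (dx θ.C p * dx X p + θ.C p * dx (dx X) p)) / (θ.C p * dx X p) ^ 2) := by
    have hne := mul_ne_zero (hC0 hp) (hX0 hp)
    have dCX := (dC hp).fun_mul (dX hp)
    have dq := differentiableAt_div (dXt hp) dCX hne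
    rw [hM, dx_sub ((differentiableAt_const U1).fun_mul ((dm hp).fun_add dq))
      (differentiableAt_const U0), dx_mul (differentiableAt_const U1) ((dm hp).fun_add dq),
      dx_add (dm hp) dq, dx_const, dx_const, dx_div (dXt hp) dCX hne, dx_mul (dC hp) (dX hp)]
    ring
  have c := hF.chain_rule hφ hks hkC hp
  have cM := (hF.chain_rule hφ hMs hmM hp).2
  have h1 := hs0 hp
  have h2 := hX0 hp
  have h3 := hC0 hp
  rw [hsp] at c
  have cx : dx θ'.C (T p.1, X p) = dx k p / dx X p := by field_simp; linear_combination c.2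
  have ct : dt θ'.C (T p.1, X p) = (dt k p - dt X p * (dx k p / dx X p)) / s p := by
    rw [← cx]; field_simp; linear_combination c.1
  have cm : dx m' (T p.1, X p) = dx M p / dx X p := by field_simp; linear_combination cM
  change dt θ'.C (T p.1, X p) / θ'.C (T p.1, X p) - θ'.C (T p.1, X p) * dx m' (T p.1, X p) =
    ((dt θ.C p / θ.C p - θ.C p * dx m p) - dt s p / s p) / s p
  rw [ct, cm, hkC p hp, kt, Mx, kx p hp]
  simp only [hk]
  generalize dx m p = m₁
  field_simp
  ring

/-- By `HasForm.splitting_eq`, the source and target functions `splitting` differ by a summand and a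
factor depending on `t` only, so their `x`-derivatives vanish at corresponding points
simultaneously. -/
theorem HasForm.inL1 (hφ : IsPointTransformation φ) (hF : HasForm φ θ T X U1 U0)
    (hθ : InL1 (base '' φ.source) θ)
    (h : ∀ p ∈ base '' φ.source,
      θ'.C (T p.1, X p) = dx X p / (deriv T p.1 * U1) * θ.C p ∧
      θ'.A2 (T p.1, X p) = dx X p ^ 2 / deriv T p.1 * θ.A2 p) :
    InL1 (base '' φ.target) θ' := by
  obtain ⟨hL, p, hp, hS⟩ := hθ
  have hD := isOpen_base_image φ.open_source
  have hss := hF.contDiffOn_deriv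
  have hst := contDiffOn_dt hD hss
  have hSs := hL.contDiffOn_splitting hD
  have hN := (hSs.sub (hst.div hss fun p hp => hF.deriv_ne_zero hp)).div hss
    fun p hp => hF.deriv_ne_zero hp
  have c := (hF.chain_rule hφ hN (fun p hp => hF.splitting_eq hφ hL h hp) hp).2
  refine ⟨hF.inL hφ hL h, _, hF.mem_base_target_iff.2 ⟨p, hp, rfl⟩, fun h0 => hS ?_⟩
  have h1 := hF.deriv_ne_zero hp
  have dS := differentiableAt_of_contDiffOn hD hSs hp
  have ds := differentiableAt_of_contDiffOn hD hss hp
  have dst := differentiableAt_of_contDiffOn hD hst hp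
  have dq := differentiableAt_div dst ds h1
  have hsx : dx (dt fun q : ℝ × ℝ => deriv T q.1) p = 0 := by
    rw [← dt_dx_comm (contDiffAt_two_of_contDiffOn hD hss hp),
      dt_congr_of_eqOn hD (g := fun _ => 0) (fun q hq => hF.dx_deriv hq) hp, dt_const]
  rw [h0, mul_zero] at c
  have c2 : dx (fun q => (splitting θ q - dt (fun q : ℝ × ℝ => deriv T q.1) q / deriv T q.1) /
      deriv T q.1) p = 0 := c.symm
  rw [dx_div (dS.fun_sub dq) ds h1, dx_sub dS dq, dx_div dst ds h1, hsx, hF.dx_deriv hp] at c2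
  field_simp at c2
  apply mul_left_cancel₀ (pow_ne_zero 2 h1)
  linear_combination c2

/-! ### Injectivity of the change of `(t, x)` and existence of target coefficients. -/

theorem injOn_of_deriv_ne_zero {F : ℝ → ℝ} {I : Set ℝ} (hI : IsPreconnected I)
    (hd : ∀ t ∈ I, deriv F t ≠ 0) : InjOn F I := by
  have hlt : ∀ a ∈ I, ∀ b ∈ I, a < b → F a ≠ F b := by
    intro a ha b hb hab he
    have hsub : Icc a b ⊆ I := hI.ordConnected.out ha hb
    obtain ⟨c, hc, hc0⟩ := exists_deriv_eq_zero hab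
      (fun t ht => (differentiableAt_of_deriv_ne_zero
        (hd t (hsub ht))).continuousAt.continuousWithinAt) he
    exact hd c (hsub (Ioo_subset_Icc_self hc)) hc0
  intro a ha b hb he
  rcases lt_trichotomy a b with hab | hab | hab
  · exact (hlt a ha b hb hab he).elim
  · exact hab
  · exact (hlt b hb a ha hab he.symm).elim

/-- Injectivity of `φ` alone does not suffice, as points over different `(t, x)` could have images
differing only in `ũ`. Connectedness of `Ω` makes the range of `t` an interval, and connectedness of
the plane slices does the same for `x` at fixed `t`; Rolle's theorem applies to `T` and then to
`X(t, ·)`. -/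
theorem HasForm.injOn (hΩ : HasConnectedSlices φ.source) (hF : HasForm φ θ T X U1 U0) :
    InjOn (fun p : ℝ × ℝ => (T p.1, X p)) (base '' φ.source) := by
  have hD := isOpen_base_image φ.open_source
  have hT : InjOn T (Prod.fst '' φ.source) := by
    refine injOn_of_deriv_ne_zero
      (hΩ.connected.isPreconnected.image _ continuous_fst.continuousOn) ?_
    rintro _ ⟨q, hq, rfl⟩
    exact hF.deriv_ne_zero (p := base q) ⟨q, hq, rfl⟩
  rintro ⟨t, x⟩ hp ⟨t', y⟩ hp' he
  simp only [Prod.mk.injEq] at he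
  obtain rfl : t = t' := hT (fst_mem_of_mem_base hp) (fst_mem_of_mem_base hp') he.1
  have hXi : InjOn (fun x => X (t, x)) (Prod.fst '' {z : ℝ × ℝ | (t, z.1, z.2) ∈ φ.source}) := by
    refine injOn_of_deriv_ne_zero ((hΩ.slice_t t).image _ continuous_fst.continuousOn) ?_
    rintro _ ⟨z, hz, rfl⟩
    have hm : (t, z.1) ∈ base '' φ.source := ⟨_, hz, rfl⟩
    have hl : HasDerivAt (fun x : ℝ => (t, x)) (0, 1) z.1 :=
      (hasDerivAt_const _ _).prodMk (hasDerivAt_id _)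
    have h1 : HasDerivAt (fun x => X (t, x)) (dx X (t, z.1)) z.1 :=
      (differentiableAt_of_contDiffOn hD hF.smooth_X hm).hasFDerivAt.comp_hasDerivAt _ hl
    rw [h1.deriv]
    exact hF.dx_ne_zero hm
  have hmem : ∀ {x}, (t, x) ∈ base '' φ.source →
      x ∈ Prod.fst '' {z : ℝ × ℝ | (t, z.1, z.2) ∈ φ.source} := by
    intro x hx
    obtain ⟨u, hu⟩ := exists_lift_mem hx
    exact ⟨(x, u), hu, rfl⟩
  rw [hXi (hmem hp) (hmem hp') he.2]

theorem HasForm.exists_coeffs (hΩ : HasConnectedSlices φ.source) (hF : HasForm φ θ T X U1 U0) :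
    ∃ θ' : Coeffs, ∀ p ∈ base '' φ.source,
      θ'.C (T p.1, X p) = dx X p / (deriv T p.1 * U1) * θ.C p ∧
      θ'.A2 (T p.1, X p) = dx X p ^ 2 / deriv T p.1 * θ.A2 p := by
  have hinv := (hF.injOn hΩ).leftInvOn_invFunOn
  set ψ := Function.invFunOn (fun p : ℝ × ℝ => (T p.1, X p)) (base '' φ.source)
  refine ⟨⟨fun y => dx X (ψ y) ^ 2 / deriv T (ψ y).1 * θ.A2 (ψ y),
    fun y => dx X (ψ y) / (deriv T (ψ y).1 * U1) * θ.C (ψ y)⟩, fun p hp => ?_⟩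
  have : ψ (T p.1, X p) = p := hinv hp
  simp only [this, and_self]

end Sufficiency

end VarBurgers

theorem mainTheorem9
    (φ : OpenPartialHomeomorph (ℝ × ℝ × ℝ) (ℝ × ℝ × ℝ))
    (hφ : VarBurgers.IsPointTransformation φ)
    (hΩ : VarBurgers.HasConnectedSlices φ.source)
    (θ : VarBurgers.Coeffs)
    (hθ : VarBurgers.InL1 (VarBurgers.base '' φ.source) θ) :
    ((∃ θ' : VarBurgers.Coeffs,
        VarBurgers.InL1 (VarBurgers.base '' φ.target) θ' ∧ VarBurgers.Connects φ θ θ') ↔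
      ∃ (T : ℝ → ℝ) (X : ℝ × ℝ → ℝ) (U1 U0 : ℝ), VarBurgers.HasForm φ θ T X U1 U0) ∧
    (∀ θ' : VarBurgers.Coeffs,
      (VarBurgers.InL1 (VarBurgers.base '' φ.target) θ' ∧ VarBurgers.Connects φ θ θ') ↔
      ∃ (T : ℝ → ℝ) (X : ℝ × ℝ → ℝ) (U1 U0 : ℝ), VarBurgers.HasForm φ θ T X U1 U0 ∧
        ∀ p ∈ VarBurgers.base '' φ.source,
          θ'.C (T p.1, X p) = VarBurgers.dx X p / (deriv T p.1 * U1) * θ.C p ∧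
          θ'.A2 (T p.1, X p) = VarBurgers.dx X p ^ 2 / deriv T p.1 * θ.A2 p) := by
  constructor
  · constructor
    · rintro ⟨θ', hθ', hc⟩
      obtain ⟨T, X, U1, U0, hF, -⟩ := hc.hasForm hφ hΩ hθ hθ'.1
      exact ⟨T, X, U1, U0, hF⟩
    · rintro ⟨T, X, U1, U0, hF⟩
      obtain ⟨θ', h⟩ := hF.exists_coeffs hΩ
      exact ⟨θ', hF.inL1 hφ hθ h, hF.connects h⟩
  · intro θ'
    constructor
    · rintro ⟨hθ', hc⟩
      exact hc.hasForm hφ hΩ hθ hθ'.1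
    · rintro ⟨T, X, U1, U0, hF, h⟩
      exact ⟨hF.inL1 hφ hθ h, hF.connects h⟩
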